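/- Consider the following decision problems. The input is a finite graph $G=(V,E)$ of order $n=|V|$ together with a non-negative integer $k$, and the question is whether there are pairwise vertex-disjoint paths $P_1,\dots,P_{k'}$ in $G$ with $k'\le k$ that together contain every vertex of $G$, where - in **UPP** the graph $G$ is undirected and simple, and the $P_i$ are arbitrary paths (nonempty sequences of pairwise distinct vertices in which consecutive vertices are adjacent; a single vertex is a path); - in **UIPP** the graph $G$ is undirected and simple, and the $P_i$ are induced paths (no two non-consecutive vertices of $P_i$ are adjacent in $G$); - in **USPP** the graph $G$ is undirected and simple, and the $P_i$ are shortest paths (no path of $G$ with the same first and the same last vertex has fewer vertices); - in **DIPP** the graph $G$ is directed and without loops (opposite arcs $(u,v)$, $(v,u)$ may both be present), and the $P_i$ are directed paths that are induced (no two non-consecutive vertices of $P_i$ are joined by an arc of $G$ in either direction); - in **DSPP** the graph $G$ is directed and without loops (opposite arcs may both be present), and the $P_i$ are directed shortest paths (no directed path of $G$ with the same first and the same last vertex has fewer vertices). **Theorem.** Each of the five problems UPP, UIPP, USPP, DIPP and DSPP is fixed-parameter tractable with respect to the dual parameter $k_d=\max(n-k,0)$. That is, for each of them there are an algorithm, a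 computable function $f:\mathbb{N}\to\mathbb{N}$ and a constant $c$ such that the algorithm decides every instance $x=(G,k)$ correctly within $f(k_d)\cdot|x|^{c}$ steps, where $|x|$ is the size of the encoding of $x$ ($n$ and $k$ in binary, and the adjacency matrix of $G$). -/

import Mathlib

namespace PathPartition

/-! ### Paths in (di)graphs

A graph or digraph on `V` enters through its adjacency (arc) relation `r`; for an undirected graph
`r` is symmetric. A path is the nonempty sequence of its pairwise distinct vertices. -/

/-- A (directed) path: a nonempty sequence of non-repeated vertices in which consecutive vertices
are joined by an edge (an arc in the direction of the sequence). -/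
def IsPath {V : Type} (r : V → V → Prop) (p : List V) : Prop :=
  p ≠ [] ∧ p.Nodup ∧ p.IsChain r

/-- An induced (chordless) path: a path in which no two non-consecutive vertices are joined by an
edge (by an arc, in either direction). -/
def IsInducedPath {V : Type} (r : V → V → Prop) (p : List V) : Prop :=
  IsPath r p ∧
    ∀ i j : Fin p.length, r (p.get i) (p.get j) → j.val = i.val + 1 ∨ i.val = j.val + 1

/-- A shortest path: a path that has the fewest vertices among all paths with the same first
and the same last vertex. -/
def IsShortestPath {V : Type} (r : V → V → Prop) (p : List V) : Prop :=
  IsPath r p ∧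
    ∀ q : List V, IsPath r q → q.head? = p.head? → q.getLast? = p.getLast? →
      p.length ≤ q.length

/-- There are pairwise vertex-disjoint sequences `P₁, …, P_{k'}` with `k' ≤ k`, each of the kind
described by `Q`, that together contain all vertices. -/
def HasPartition {V : Type} (Q : List V → Prop) (k : ℕ) : Prop :=
  ∃ Ps : List (List V), Ps.length ≤ k ∧ (∀ P ∈ Ps, Q P) ∧ Ps.Pairwise List.Disjoint ∧
    ∀ v : V, ∃ P ∈ Ps, v ∈ P

/-! ### Machine model

A random access machine with structured control: natural-number registers and arrays (of which a
program can mention only finitely many), indirect addressing through arrays, addition and truncated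
subtraction as arithmetic (no multiplication), unit cost per operation. In `t` steps the bit length
of the numbers involved grows by at most `O(t)`, so running times are polynomially related to those
of Turing machines. -/

/-- Contents of the registers, and of the cells of the arrays. -/
structure State where
  reg : ℕ → ℕ
  arr : ℕ → ℕ → ℕ

/-- Expressions: constants, registers, array cells, sum, truncated difference. -/
inductive Expr where
  | const (c : ℕ)
  | reg (x : ℕ)
  | get (a : ℕ) (i : Expr)
  | add (e₁ e₂ : Expr)
  | sub (e₁ e₂ : Expr)

def Expr.eval (s : State) : Expr → ℕ
  | .const c => c
  | .reg x => s.reg x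
  | .get a i => s.arr a (i.eval s)
  | .add e₁ e₂ => e₁.eval s + e₂.eval s
  | .sub e₁ e₂ => e₁.eval s - e₂.eval s

/-- Number of elementary operations needed to evaluate an expression. -/
def Expr.cost : Expr → ℕ
  | .const _ => 1
  | .reg _ => 1
  | .get _ i => i.cost + 1
  | .add e₁ e₂ => e₁.cost + e₂.cost + 1
  | .sub e₁ e₂ => e₁.cost + e₂.cost + 1

/-- Programs. A test succeeds when the value of its expression is nonzero. -/
inductive Prog where
  | assign (x : ℕ) (e : Expr)
  | store (a : ℕ) (i e : Expr)
  | seq (p q : Prog)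
  | branch (e : Expr) (p q : Prog)
  | loop (e : Expr) (p : Prog)

/-- `Runs p s t s'`: started in state `s`, the program `p` halts after exactly `t` steps, in
state `s'`. -/
inductive Runs : Prog → State → ℕ → State → Prop where
  | assign (x : ℕ) (e : Expr) (s : State) :
      Runs (.assign x e) s (e.cost + 1) { s with reg := Function.update s.reg x (e.eval s) }
  | store (a : ℕ) (i e : Expr) (s : State) :
      Runs (.store a i e) s (i.cost + e.cost + 1)
        { s with
          arr := Function.update s.arr a (Function.update (s.arr a) (i.eval s) (e.eval s)) }
  | seq {p q : Prog} {s s' s'' : State} {t t' : ℕ} (hp : Runs p s t s') (hq : Runs q s' t' s'') :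
      Runs (.seq p q) s (t + t') s''
  | branch_true {e : Expr} {p q : Prog} {s s' : State} {t : ℕ} (he : e.eval s ≠ 0)
      (hp : Runs p s t s') : Runs (.branch e p q) s (e.cost + 1 + t) s'
  | branch_false {e : Expr} {p q : Prog} {s s' : State} {t : ℕ} (he : e.eval s = 0)
      (hq : Runs q s t s') : Runs (.branch e p q) s (e.cost + 1 + t) s'
  | loop_exit {e : Expr} {p : Prog} {s : State} (he : e.eval s = 0) :
      Runs (.loop e p) s (e.cost + 1) s
  | loop_step {e : Expr} {p : Prog} {s s' s'' : State} {t t' : ℕ} (he : e.eval s ≠ 0)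
      (hp : Runs p s t s') (hl : Runs (.loop e p) s' t' s'') :
      Runs (.loop e p) s (e.cost + 1 + t + t') s''

/-- The machine is deterministic: running time and final state are determined by the start. -/
theorem Runs.det {p : Prog} {s s₁ s₂ : State} {t₁ t₂ : ℕ} (h₁ : Runs p s t₁ s₁)
    (h₂ : Runs p s t₂ s₂) : t₁ = t₂ ∧ s₁ = s₂ := by
  induction h₁ generalizing t₂ s₂ with
  | assign x e s => cases h₂; exact ⟨rfl, rfl⟩
  | store a i e s => cases h₂; exact ⟨rfl, rfl⟩
  | seq _ _ ih₁ ih₂ =>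
    cases h₂ with
    | seq hp hq =>
      obtain ⟨rfl, rfl⟩ := ih₁ hp
      obtain ⟨rfl, rfl⟩ := ih₂ hq
      exact ⟨rfl, rfl⟩
  | branch_true he _ ih =>
    cases h₂ with
    | branch_true _ hp => obtain ⟨rfl, rfl⟩ := ih hp; exact ⟨rfl, rfl⟩
    | branch_false he' _ => exact absurd he' he
  | branch_false he _ ih =>
    cases h₂ with
    | branch_true he' _ => exact absurd he he'
    | branch_false _ hq => obtain ⟨rfl, rfl⟩ := ih hq; exact ⟨rfl, rfl⟩
  | loop_exit he =>
    cases h₂ with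
    | loop_exit _ => exact ⟨rfl, rfl⟩
    | loop_step he' _ _ => exact absurd he he'
  | loop_step he _ _ ih₁ ih₂ =>
    cases h₂ with
    | loop_exit he' => exact absurd he' he
    | loop_step _ hp hl =>
      obtain ⟨rfl, rfl⟩ := ih₁ hp
      obtain ⟨rfl, rfl⟩ := ih₂ hl
      exact ⟨rfl, rfl⟩

/-- Initial state: the input word is in array `0`, its length in register `0`; everything else
is `0`. -/
def initState (w : List ℕ) : State where
  reg x := if x = 0 then w.length else 0
  arr a i := if a = 0 then w.getD i 0 else 0

/-- Size of an input word: number of entries plus the total number of their binary digits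
(plus one). -/
def inputSize (w : List ℕ) : ℕ := (w.map fun a => Nat.size a + 1).sum + 1

/-! ### Parameterized problems -/

/-- A parameterized decision problem: instances, their encoding as machine input, the
Yes-instances, and the parameter. -/
structure ParamProblem where
  Inst : Type
  code : Inst → List ℕ
  yes : Inst → Prop
  param : Inst → ℕ

/-- Fixed-parameter tractability: one program, a computable function `f` and a constant `c`, such
that the program halts on each instance `x` within `f (param x) * |x| ^ c` steps, and register `0`
is then nonzero exactly when `x` is a Yes-instance. -/
def ParamProblem.IsFPT (P : ParamProblem) : Prop :=
  ∃ (p : Prog) (f : ℕ → ℕ) (c : ℕ), Computable f ∧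
    ∀ x : P.Inst, ∃ (t : ℕ) (s : State),
      Runs p (initState (P.code x)) t s ∧
      t ≤ f (P.param x) * inputSize (P.code x) ^ c ∧
      (s.reg 0 ≠ 0 ↔ P.yes x)

/-! ### The path partition problems with dual parameterization -/

/-- An undirected graph of order `n` together with a bound `k` on the number of paths. -/
structure UInst where
  n : ℕ
  G : SimpleGraph (Fin n)
  k : ℕ

/-- A loopless directed graph of order `n` (a pair of opposite arcs is allowed) together with a
bound `k` on the number of paths. -/
structure DInst where
  n : ℕ
  G : Digraph (Fin n)
  loopless : ∀ v, ¬ G.Adj v v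
  k : ℕ

open Classical in
/-- Encoding of an instance: `n`, `k`, and then the adjacency matrix row by row. -/
noncomputable def graphCode (n k : ℕ) (r : Fin n → Fin n → Prop) : List ℕ :=
  n :: k :: List.ofFn fun p : Fin (n * n) => if r p.divNat p.modNat then 1 else 0

/-- The problem of partitioning an undirected graph of order `n` into at most `k` paths of the kind
`Q`, with parameter `n - k` (which is `0` when `k ≥ n`). -/
noncomputable def undirectedDual (Q : {V : Type} → (V → V → Prop) → List V → Prop) :
    ParamProblem where
  Inst := UInst
  code x := graphCode x.n x.k x.G.Adj
  yes x := HasPartition (Q x.G.Adj) x.k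
  param x := x.n - x.k

/-- The same problem for directed graphs. -/
noncomputable def directedDual (Q : {V : Type} → (V → V → Prop) → List V → Prop) :
    ParamProblem where
  Inst := DInst
  code x := graphCode x.n x.k x.G.Adj
  yes x := HasPartition (Q x.G.Adj) x.k
  param x := x.n - x.k

noncomputable def UPP : ParamProblem := undirectedDual IsPath
noncomputable def UIPP : ParamProblem := undirectedDual IsInducedPath
noncomputable def USPP : ParamProblem := undirectedDual IsShortestPath
noncomputable def DIPP : ParamProblem := directedDual IsInducedPath
noncomputable def DSPP : ParamProblem := directedDual IsShortestPath

end PathPartition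

/-!
A partition of a graph of order `n` into at most `k` paths is the same as a packing of disjoint
paths with at least `d = n - k` edges, since the vertices that are left over can be added as paths
of their own (`hasPartition_iff_packing`). Subpaths of induced or shortest paths are again of that
kind, so the packing may be taken to have exactly `d` edges and no single vertices
(`IsPacking.exists_edgeCount_eq`); then it has at most `d` paths and at most `2 * d` vertices.

Call two vertices twins if they have the same neighbours, and let the core consist of the vertices
with fewer than `2 * d` twins before them. Exchanging twins is an automorphism of the graph, so a
set of at most `2 * d` vertices can be moved into the core by an automorphism
(`exists_automorphism`). Hence it suffices to search the core for a packing, and likewise for the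
shorter paths that show a path not to be a shortest one. If there are no `d` disjoint arcs then at
most `2 * d` vertices meet all arcs, and the core has at most `2 ^ (7 * d)` vertices, because the
vertices outside of such a cover are classified up to twins by their neighbours in the cover
(`card_core_le`). On the other hand `d` disjoint arcs are a packing of the required kind. So the
answer is Yes if the core is larger than that, and is found by exhaustive search in the core
otherwise.

All of this applies to any loopless arc relation, symmetric or not, and to any kind of paths that
is closed under subpaths and automorphisms and contains the single vertices and the arcs
(`IsPathKind`).

The machine enters through a small language `Tm` of terms with bounded sums. A term is compiled to
a program that computes it (`Tm.compile_runs`), and its running time is bounded by a computable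
function of `d` times a power of the input size as soon as the exponents of the powers of two in
it are bounded in terms of `d` (`Tm.bound`), which is a syntactic condition, `Tm.ok`. Bounded
quantifiers are sums, and a candidate packing is a number below `2 ^ (7 * d * (d * (d + 1)))`,
whose digits to the base `2 ^ (7 * d)` are the positions in the core of the vertices. Hence the
whole procedure is one term, `Tm.solve`, whose meaning is computed in `holds_solve`.
-/

namespace PathPartition

/-! ### A term language with bounded sums, and its compilation -/

/-- Terms for natural-number valued functions of an input graph and finitely many arguments.
Variables are de Bruijn indices: `sum a b` is `∑ i < a, b`, with the summation index as variable
`0` of `b`. In `call f a b c` the term `f` is closed but for its three arguments, which are its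
variables `0`, `1` and `2`, so that no term ever has to be substituted or shifted. -/
inductive Tm where
  | const (c : ℕ)
  | var (i : ℕ)
  | order
  | par
  | entry (e : Tm)
  | add (a b : Tm)
  | sub (a b : Tm)
  | mul (a b : Tm)
  | pow2 (a : Tm)
  | sum (a b : Tm)
  | call (f a b c : Tm)

/-- What a term can see of the input: the order of the graph, the dual parameter, and the entries
of the adjacency matrix as one sequence. -/
structure Input where
  order : ℕ
  par : ℕ
  entry : ℕ → ℕ

/-- Extension of an environment by a new variable `0`. -/
def extend {α : Type} (x : α) (ρ : ℕ → α) : ℕ → α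
  | 0 => x
  | i + 1 => ρ i

/-- The environment of a called term: its three arguments (the last one is repeated forever). -/
def args {α : Type} (x y z : α) : ℕ → α
  | 0 => x
  | 1 => y
  | _ => z

/-- The value of a term on an input, for given values of the variables. -/
def Tm.eval (I : Input) : Tm → (ℕ → ℕ) → ℕ
  | .const c, _ => c
  | .var i, ρ => ρ i
  | .order, _ => I.order
  | .par, _ => I.par
  | .entry e, ρ => I.entry (e.eval I ρ)
  | .add a b, ρ => a.eval I ρ + b.eval I ρ
  | .sub a b, ρ => a.eval I ρ - b.eval I ρ
  | .mul a b, ρ => a.eval I ρ * b.eval I ρ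
  | .pow2 a, ρ => 2 ^ a.eval I ρ
  | .sum a b, ρ => ∑ i ∈ Finset.range (a.eval I ρ), b.eval I (extend i ρ)
  | .call f a b c, ρ => f.eval I (args (a.eval I ρ) (b.eval I ρ) (c.eval I ρ))

/-- The exact running time of the compiled term. -/
def Tm.cost (I : Input) : Tm → (ℕ → ℕ) → ℕ
  | .const _, _ => 2
  | .var _, _ => 2
  | .order, _ => 3
  | .par, _ => 6
  | .entry e, ρ => e.cost I ρ + 5
  | .add a b, ρ => a.cost I ρ + b.cost I ρ + 4
  | .sub a b, ρ => a.cost I ρ + b.cost I ρ + 4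
  | .mul a b, ρ => a.cost I ρ + b.cost I ρ + a.eval I ρ * 10 + 4
  | .pow2 a, ρ => a.cost I ρ + a.eval I ρ * 10 + 4
  | .sum a b, ρ =>
      a.cost I ρ + ∑ i ∈ Finset.range (a.eval I ρ), (b.cost I (extend i ρ) + 12) + 8
  | .call f a b c, ρ => a.cost I ρ + b.cost I ρ + c.cost I ρ +
      f.cost I (args (a.eval I ρ) (b.eval I ρ) (c.eval I ρ)) + 2

/-- Add register `y` to register `x`. -/
def accumulate (x y : ℕ) : Prog := .assign x (.add (.reg x) (.reg y))

/-- Repeat `p` as often as register `x` says, counting `x` down. -/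
def repeatDown (x : ℕ) (p : Prog) : Prog :=
  .loop (.reg x) (.seq p (.assign x (.sub (.reg x) (.const 1))))

/-- The program that computes a term into register `k`. The variables of the term are found in
the registers `γ i`, all of them below `k`; registers from `k` on serve as working space. -/
def Tm.compile : Tm → (ℕ → ℕ) → ℕ → Prog
  | .const c, _, k => .assign k (.const c)
  | .var i, γ, k => .assign k (.reg (γ i))
  | .order, _, k => .assign k (.get 0 (.const 0))
  | .par, _, k => .assign k (.sub (.get 0 (.const 0)) (.get 0 (.const 1)))
  | .entry e, γ, k => .seq (e.compile γ k) (.assign k (.get 0 (.add (.reg k) (.const 2))))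
  | .add a b, γ, k => .seq (a.compile γ k) (.seq (b.compile γ (k + 1)) (accumulate k (k + 1)))
  | .sub a b, γ, k => .seq (a.compile γ k) (.seq (b.compile γ (k + 1))
      (.assign k (.sub (.reg k) (.reg (k + 1)))))
  | .mul a b, γ, k => .seq (a.compile γ (k + 1)) (.seq (b.compile γ (k + 2))
      (.seq (.assign k (.const 0)) (repeatDown (k + 1) (accumulate k (k + 2)))))
  | .pow2 a, γ, k => .seq (a.compile γ (k + 1))
      (.seq (.assign k (.const 1)) (repeatDown (k + 1) (accumulate k k)))
  | .sum a b, γ, k => .seq (a.compile γ (k + 1)) (.seq (.assign k (.const 0))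
      (.seq (.assign (k + 2) (.const 0)) (.loop (.sub (.reg (k + 1)) (.reg (k + 2)))
        (.seq (b.compile (extend (k + 2) γ) (k + 3)) (.seq (accumulate k (k + 3))
          (.assign (k + 2) (.add (.reg (k + 2)) (.const 1))))))))
  | .call f a b c, γ, k => .seq (a.compile γ (k + 1)) (.seq (b.compile γ (k + 2))
      (.seq (c.compile γ (k + 3)) (.seq (f.compile (args (k + 1) (k + 2) (k + 3)) (k + 4))
        (.assign k (.reg (k + 4))))))

/-- The arrays of the machine hold the given input. -/
def Input.StoredIn (I : Input) (m : ℕ → ℕ → ℕ) : Prop :=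
  m 0 0 = I.order ∧ m 0 0 - m 0 1 = I.par ∧ ∀ i, m 0 (i + 2) = I.entry i

theorem Runs.congr_time {p : Prog} {s s' : State} {t t' : ℕ} (h : Runs p s t s') (ht : t = t') :
    Runs p s t' s' := ht ▸ h

/-- The loop rule: an invariant that counts the iterations. -/
theorem Runs.loop_invariant {e : Expr} {p : Prog} (Inv : ℕ → State → Prop) (t : ℕ → ℕ) (m : ℕ)
    (step : ∀ i < m, ∀ s, Inv i s → e.eval s ≠ 0 ∧ ∃ s', Runs p s (t i) s' ∧ Inv (i + 1) s')
    (done : ∀ s, Inv m s → e.eval s = 0) (s : State) (hs : Inv 0 s) :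
    ∃ s', Runs (.loop e p) s (∑ i ∈ Finset.range m, (e.cost + 1 + t i) + (e.cost + 1)) s' ∧
      Inv m s' := by
  induction m generalizing Inv t s with
  | zero => exact ⟨s, by simpa using Runs.loop_exit (done s hs), hs⟩
  | succ m ih =>
    obtain ⟨he, s₁, h₁, hs₁⟩ := step 0 (by omega) s hs
    obtain ⟨s₂, h₂, hs₂⟩ := ih (fun i => Inv (i + 1)) (fun i => t (i + 1))
      (fun i hi => step (i + 1) (by omega)) done s₁ hs₁
    refine ⟨s₂, ?_, hs₂⟩
    refine (Runs.loop_step he h₁ h₂).congr_time ?_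
    rw [Finset.sum_range_succ']
    ring

/-- The state `s` with the register `x` set to `v`. -/
def State.set (s : State) (x v : ℕ) : State := { s with reg := Function.update s.reg x v }

theorem Runs.assign_set (x : ℕ) (e : Expr) (s : State) :
    Runs (.assign x e) s (e.cost + 1) (s.set x (e.eval s)) := Runs.assign x e s

@[simp] theorem State.set_reg_self (s : State) (x v : ℕ) : (s.set x v).reg x = v := by
  simp [State.set]

theorem State.set_reg_of_ne (s : State) {x y : ℕ} (v : ℕ) (h : y ≠ x) :
    (s.set x v).reg y = s.reg y := by
  simp [State.set, h]

/-- `s'` agrees with `s` but for the registers from `k` on. -/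
def State.AgreesBelow (k : ℕ) (s s' : State) : Prop :=
  s'.arr = s.arr ∧ ∀ x < k, s'.reg x = s.reg x

theorem State.AgreesBelow.refl (k : ℕ) (s : State) : s.AgreesBelow k s := ⟨rfl, fun _ _ => rfl⟩

theorem State.AgreesBelow.trans {k l : ℕ} {s s' s'' : State} (h : s.AgreesBelow k s')
    (h' : s'.AgreesBelow l s'') (hkl : k ≤ l) : s.AgreesBelow k s'' :=
  ⟨h'.1.trans h.1, fun x hx => (h'.2 x (hx.trans_le hkl)).trans (h.2 x hx)⟩

theorem State.AgreesBelow.mono {k l : ℕ} {s s' : State} (h : s.AgreesBelow l s') (hkl : k ≤ l) :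
    s.AgreesBelow k s' :=
  ⟨h.1, fun x hx => h.2 x (hx.trans_le hkl)⟩

theorem State.AgreesBelow.set {k x : ℕ} {s s' : State} (h : s.AgreesBelow k s') (hx : k ≤ x)
    (v : ℕ) : s.AgreesBelow k (s'.set x v) :=
  ⟨h.1, fun y hy => by rw [State.set_reg_of_ne _ _ (by omega), h.2 y hy]⟩

theorem Runs.repeatDown {x : ℕ} {p : Prog} (Inv : ℕ → State → Prop) (c m : ℕ)
    (step : ∀ i < m, ∀ s, Inv i s → ∃ s', Runs p s c s' ∧ s'.reg x = s.reg x ∧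
      Inv (i + 1) (s'.set x (s.reg x - 1))) (s : State) (hs : Inv 0 s) (hx : s.reg x = m) :
    ∃ s', Runs (repeatDown x p) s (m * (c + 6) + 2) s' ∧ Inv m s' := by
  obtain ⟨s', h, hs'⟩ := Runs.loop_invariant (e := .reg x)
    (p := .seq p (.assign x (.sub (.reg x) (.const 1))))
    (fun i s => Inv i s ∧ s.reg x = m - i) (fun _ => c + 4) m
    (fun i hi s hs => by
      obtain ⟨s', h, hx', hI⟩ := step i hi s hs.1
      refine ⟨by simp only [Expr.eval, hs.2]; omega, _, Runs.seq h (Runs.assign_set _ _ _), ?_, ?_⟩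
      · simpa [Expr.eval, hx'] using hI
      · simp only [Expr.eval, State.set_reg_self, hx', hs.2]
        omega)
    (fun s hs => by simp [Expr.eval, hs.2]) s ⟨hs, by omega⟩
  refine ⟨s', ?_, hs'.1⟩
  refine h.congr_time ?_
  simp only [Expr.cost, Finset.sum_const, Finset.card_range, smul_eq_mul]
  ring

/-- Compiled terms compute their values, in the time that `Tm.cost` says. -/
theorem Tm.compile_runs (I : Input) (e : Tm) (γ : ℕ → ℕ) (k : ℕ) (ρ : ℕ → ℕ) (s : State)
    (hI : I.StoredIn s.arr) (hγ : ∀ i, γ i < k) (hρ : ∀ i, s.reg (γ i) = ρ i) :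
    ∃ s', Runs (e.compile γ k) s (e.cost I ρ) s' ∧ s.AgreesBelow k s' ∧
      s'.reg k = e.eval I ρ := by
  induction e generalizing γ k ρ s with
  | const c =>
    exact ⟨_, Runs.assign_set _ _ _, (State.AgreesBelow.refl k s).set le_rfl _,
      by simp [Expr.eval, Tm.eval]⟩
  | var i =>
    exact ⟨_, Runs.assign_set _ _ _, (State.AgreesBelow.refl k s).set le_rfl _,
      by simp [Expr.eval, Tm.eval, hρ]⟩
  | order =>
    exact ⟨_, Runs.assign_set _ _ _, (State.AgreesBelow.refl k s).set le_rfl _,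
      by simp [Expr.eval, Tm.eval, hI.1]⟩
  | par =>
    exact ⟨_, Runs.assign_set _ _ _, (State.AgreesBelow.refl k s).set le_rfl _,
      by simp [Expr.eval, Tm.eval, hI.2.1]⟩
  | entry e ih =>
    obtain ⟨s₁, h₁, a₁, v₁⟩ := ih γ k ρ s hI hγ hρ
    refine ⟨_, Runs.seq h₁ (Runs.assign_set _ _ _), a₁.set le_rfl _, ?_⟩
    simp [Expr.eval, Tm.eval, v₁, a₁.1, hI.2.2]
  | add a b iha ihb =>
    obtain ⟨s₁, h₁, a₁, v₁⟩ := iha γ k ρ s hI hγ hρ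
    obtain ⟨s₂, h₂, a₂, v₂⟩ := ihb γ (k + 1) ρ s₁ (by rwa [a₁.1]) (fun i => (hγ i).trans (by omega))
      (fun i => by rw [a₁.2 _ (hγ i), hρ])
    refine ⟨_, (Runs.seq h₁ (Runs.seq h₂ (Runs.assign_set _ _ _))).congr_time
      (by simp only [Tm.cost, Expr.cost]; ring), (a₁.trans a₂ (by omega)).set le_rfl _, ?_⟩
    simp [Expr.eval, Tm.eval, v₂, a₂.2 k (by omega), v₁]
  | sub a b iha ihb =>
    obtain ⟨s₁, h₁, a₁, v₁⟩ := iha γ k ρ s hI hγ hρ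
    obtain ⟨s₂, h₂, a₂, v₂⟩ := ihb γ (k + 1) ρ s₁ (by rwa [a₁.1]) (fun i => (hγ i).trans (by omega))
      (fun i => by rw [a₁.2 _ (hγ i), hρ])
    refine ⟨_, (Runs.seq h₁ (Runs.seq h₂ (Runs.assign_set _ _ _))).congr_time
      (by simp only [Tm.cost, Expr.cost]; ring), (a₁.trans a₂ (by omega)).set le_rfl _, ?_⟩
    simp [Expr.eval, Tm.eval, v₂, a₂.2 k (by omega), v₁]
  | mul a b iha ihb =>
    obtain ⟨s₁, h₁, a₁, v₁⟩ := iha γ (k + 1) ρ s hI (fun i => (hγ i).trans (by omega)) hρ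
    obtain ⟨s₂, h₂, a₂, v₂⟩ := ihb γ (k + 2) ρ s₁ (by rwa [a₁.1]) (fun i => (hγ i).trans (by omega))
      (fun i => by rw [a₁.2 _ ((hγ i).trans (by omega)), hρ])
    obtain ⟨s₃, h₃, ⟨a₃, v₃, w₃⟩⟩ := Runs.repeatDown (x := k + 1) (p := accumulate k (k + 2))
      (fun i s' => s.AgreesBelow k s' ∧ s'.reg (k + 2) = b.eval I ρ ∧
        s'.reg k = i * b.eval I ρ) 4 (a.eval I ρ)
      (fun i _ s' hs' => ⟨_, Runs.assign_set _ _ _, State.set_reg_of_ne _ _ (by omega),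
        (hs'.1.set le_rfl _).set (by omega) _, by
          rw [State.set_reg_of_ne _ _ (by omega), State.set_reg_of_ne _ _ (by omega), hs'.2.1], by
          rw [State.set_reg_of_ne _ _ (by omega), State.set_reg_self]
          simp only [Expr.eval, hs'.2.1, hs'.2.2]; ring⟩)
      (s₂.set k 0) ⟨((a₁.mono (by omega)).trans a₂ (by omega)).set le_rfl _, by
        rw [State.set_reg_of_ne _ _ (by omega), v₂], by simp⟩
      (by rw [State.set_reg_of_ne _ _ (by omega), a₂.2 _ (by omega), v₁])
    refine ⟨s₃, ?_, a₃, w₃⟩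
    refine (Runs.seq h₁ (Runs.seq h₂ (Runs.seq (Runs.assign_set k (.const 0) s₂) h₃))).congr_time ?_
    simp only [Tm.cost, Expr.cost]; ring
  | pow2 a iha =>
    obtain ⟨s₁, h₁, a₁, v₁⟩ := iha γ (k + 1) ρ s hI (fun i => (hγ i).trans (by omega)) hρ
    obtain ⟨s₃, h₃, ⟨a₃, w₃⟩⟩ := Runs.repeatDown (x := k + 1) (p := accumulate k k)
      (fun i s' => s.AgreesBelow k s' ∧ s'.reg k = 2 ^ i) 4 (a.eval I ρ)
      (fun i _ s' hs' => ⟨_, Runs.assign_set _ _ _, State.set_reg_of_ne _ _ (by omega),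
        (hs'.1.set le_rfl _).set (by omega) _, by
          rw [State.set_reg_of_ne _ _ (by omega), State.set_reg_self]
          simp only [Expr.eval, hs'.2]; ring⟩)
      (s₁.set k 1) ⟨(a₁.mono (by omega)).set le_rfl _, by simp⟩
      (by rw [State.set_reg_of_ne _ _ (by omega), v₁])
    refine ⟨s₃, ?_, a₃, w₃⟩
    refine (Runs.seq h₁ (Runs.seq (Runs.assign_set k (.const 1) s₁) h₃)).congr_time ?_
    simp only [Tm.cost, Expr.cost]; ring
  | sum a b iha ihb =>
    obtain ⟨s₁, h₁, a₁, v₁⟩ := iha γ (k + 1) ρ s hI (fun i => (hγ i).trans (by omega)) hρ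
    obtain ⟨s₃, h₃, ⟨a₃, v₃, u₃, w₃⟩⟩ := Runs.loop_invariant
      (e := .sub (.reg (k + 1)) (.reg (k + 2)))
      (p := .seq (b.compile (extend (k + 2) γ) (k + 3)) (.seq (accumulate k (k + 3))
          (.assign (k + 2) (.add (.reg (k + 2)) (.const 1)))))
      (fun i s' => s.AgreesBelow k s' ∧ s'.reg (k + 1) = a.eval I ρ ∧ s'.reg (k + 2) = i ∧
        s'.reg k = ∑ j ∈ Finset.range i, b.eval I (extend j ρ))
      (fun i => b.cost I (extend i ρ) + 8) (a.eval I ρ)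
      (fun i hi s' ⟨a', v', u', w'⟩ => by
        obtain ⟨s₂, h₂, a₂, v₂⟩ := ihb (extend (k + 2) γ) (k + 3) (extend i ρ) s' (by rwa [a'.1])
          (fun j => by
            cases j with
            | zero => simp [extend]
            | succ j => exact (hγ j).trans (by omega))
          (fun j => by
            cases j with
            | zero => simpa [extend] using u'
            | succ j => simp only [extend]; rw [a'.2 _ (hγ j), hρ])
        refine ⟨by simp only [Expr.eval, v', u']; omega, _, Runs.seq h₂ (Runs.seq
          (Runs.assign_set _ _ _) (Runs.assign_set _ _ _)),
          (((a'.trans a₂ (by omega)).set le_rfl _).set (by omega) _), ?_, ?_, ?_⟩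
        · rw [State.set_reg_of_ne _ _ (by omega), State.set_reg_of_ne _ _ (by omega),
            a₂.2 _ (by omega), v']
        · simp only [State.set_reg_self, Expr.eval]
          rw [State.set_reg_of_ne _ _ (by omega), a₂.2 _ (by omega), u']
        · rw [State.set_reg_of_ne _ _ (by omega), State.set_reg_self, Finset.sum_range_succ]
          simp only [Expr.eval, v₂]
          rw [a₂.2 _ (by omega), w'])
      (fun s' hs' => by simp [Expr.eval, hs'.2.1, hs'.2.2.1])
      ((s₁.set k 0).set (k + 2) 0)
      ⟨((a₁.mono (by omega)).set le_rfl _).set (by omega) _, by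
        rw [State.set_reg_of_ne _ _ (by omega), State.set_reg_of_ne _ _ (by omega), v₁],
        by simp, by rw [State.set_reg_of_ne _ _ (by omega)]; simp⟩
    refine ⟨s₃, ?_, a₃, w₃⟩
    refine (Runs.seq h₁ (Runs.seq (Runs.assign_set k (.const 0) s₁)
      (Runs.seq (Runs.assign_set (k + 2) (.const 0) _) h₃))).congr_time ?_
    simp only [Tm.cost, Expr.cost, Finset.sum_add_distrib, Finset.sum_const, Finset.card_range,
      smul_eq_mul]
    ring
  | call f a b c ihf iha ihb ihc =>
    obtain ⟨s₁, h₁, a₁, v₁⟩ := iha γ (k + 1) ρ s hI (fun i => (hγ i).trans (by omega)) hρ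
    obtain ⟨s₂, h₂, a₂, v₂⟩ := ihb γ (k + 2) ρ s₁ (by rwa [a₁.1]) (fun i => (hγ i).trans (by omega))
      (fun i => by rw [a₁.2 _ ((hγ i).trans (by omega)), hρ])
    have a₁₂ := a₁.trans a₂ (by omega)
    obtain ⟨s₃, h₃, a₃, v₃⟩ := ihc γ (k + 3) ρ s₂ (by rwa [a₁₂.1])
      (fun i => (hγ i).trans (by omega))
      (fun i => by rw [a₁₂.2 _ ((hγ i).trans (by omega)), hρ])
    have a₁₃ := a₁₂.trans a₃ (by omega)
    obtain ⟨s₄, h₄, a₄, v₄⟩ := ihf (args (k + 1) (k + 2) (k + 3)) (k + 4)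
      (args (a.eval I ρ) (b.eval I ρ) (c.eval I ρ)) s₃ (by rwa [a₁₃.1])
      (fun i => by
        match i with
        | 0 | 1 | _ + 2 => simp [args])
      (fun i => by
        match i with
        | 0 => simp only [args]; rw [a₃.2 _ (by omega), a₂.2 _ (by omega), v₁]
        | 1 => simp only [args]; rw [a₃.2 _ (by omega), v₂]
        | _ + 2 => simpa only [args] using v₃)
    refine ⟨_, (Runs.seq h₁ (Runs.seq h₂ (Runs.seq h₃ (Runs.seq h₄
      (Runs.assign_set _ _ _))))).congr_time (by simp only [Tm.cost, Expr.cost]; ring),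
      ((a₁₃.trans a₄ (by omega)).mono (by omega)).set le_rfl _, ?_⟩
    simpa [Expr.eval, Tm.eval] using v₄

/-! ### Running times of compiled terms -/

/-- Whether the value of the term is bounded only by a function of the parameter times a power of
the size of the input (`true`), or by a function of the parameter alone (`false`); `Γ` tells this
for the variables. -/
def Tm.large : Tm → (ℕ → Bool) → Bool
  | .const _, _ => false
  | .var i, Γ => Γ i
  | .order, _ => true
  | .par, _ => false
  | .entry _, _ => false
  | .add a b, Γ => a.large Γ || b.large Γ
  | .sub a _, Γ => a.large Γ
  | .mul a b, Γ => a.large Γ || b.large Γ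
  | .pow2 _, _ => false
  | .sum a b, Γ => a.large Γ || b.large (extend (a.large Γ) Γ)
  | .call f a b c, Γ => f.large (args (a.large Γ) (b.large Γ) (c.large Γ))

/-- The exponents of all powers in the term are bounded by functions of the parameter. -/
def Tm.ok : Tm → (ℕ → Bool) → Bool
  | .const _, _ => true
  | .var _, _ => true
  | .order, _ => true
  | .par, _ => true
  | .entry e, Γ => e.ok Γ
  | .add a b, Γ => a.ok Γ && b.ok Γ
  | .sub a b, Γ => a.ok Γ && b.ok Γ
  | .mul a b, Γ => a.ok Γ && b.ok Γ
  | .pow2 a, Γ => a.ok Γ && !a.large Γ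
  | .sum a b, Γ => a.ok Γ && b.ok (extend (a.large Γ) Γ)
  | .call f a b c, Γ => a.ok Γ && b.ok Γ && c.ok Γ &&
      f.ok (args (a.large Γ) (b.large Γ) (c.large Γ))

theorem le_mul_pow_mono {x g g' m e e' : ℕ} (h : x ≤ g * m ^ e) (hm : 1 ≤ m) (hg : g ≤ g')
    (he : e ≤ e') : x ≤ g' * m ^ e' :=
  h.trans (Nat.mul_le_mul hg (Nat.pow_le_pow_right hm he))

theorem le_mul_pow_of_le {x g m e : ℕ} (h : x ≤ g) (hm : 1 ≤ m) : x ≤ g * m ^ e :=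
  h.trans (Nat.le_mul_of_pos_right g (Nat.pow_pos hm))

theorem primrec_two_pow {f : ℕ → ℕ} (hf : Primrec f) : Primrec fun d => 2 ^ f d := by
  have h : Primrec₂ fun a b : ℕ => a ^ b := Primrec₂.unpaired'.1 Nat.Primrec.pow
  exact h.comp (Primrec.const 2) hf

theorem primrec_add {f g : ℕ → ℕ} (hf : Primrec f) (hg : Primrec g) :
    Primrec fun d => f d + g d := Primrec.nat_add.comp hf hg

theorem primrec_mul {f g : ℕ → ℕ} (hf : Primrec f) (hg : Primrec g) :
    Primrec fun d => f d * g d := Primrec.nat_mul.comp hf hg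

/-- The values and running times of a term are bounded by a computable function of the parameter
times a power of the size `m`, if this is so for the values of the variables; and the power is not
needed for the value when `Tm.large` says so. -/
theorem Tm.bound (e : Tm) (Γ : ℕ → Bool) (hok : e.ok Γ = true) (f : ℕ → ℕ) (hf : Primrec f)
    (c : ℕ) : ∃ (g : ℕ → ℕ) (c' : ℕ), Primrec g ∧ ∀ (I : Input) (m : ℕ) (ρ : ℕ → ℕ), 1 ≤ m →
      I.order ≤ m → (∀ i, I.entry i ≤ 1) → (∀ i, ρ i ≤ f I.par * m ^ cond (Γ i) c 0) →
      e.eval I ρ ≤ g I.par * m ^ cond (e.large Γ) c' 0 ∧ e.cost I ρ ≤ g I.par * m ^ c' := by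
  induction e generalizing Γ f c with
  | const n =>
    refine ⟨fun _ => n + 2, 0, Primrec.const _, fun I m ρ hm _ _ _ => ⟨?_, ?_⟩⟩
    · exact le_mul_pow_of_le (by simp [Tm.eval]) hm
    · exact le_mul_pow_of_le (by simp [Tm.cost]) hm
  | var i =>
    refine ⟨fun d => f d + 2, c, primrec_add hf (Primrec.const _), fun I m ρ hm _ _ hρ => ⟨?_, ?_⟩⟩
    · exact le_mul_pow_mono (hρ i) hm (by dsimp only; omega) le_rfl
    · exact le_mul_pow_of_le (by simp [Tm.cost]) hm
  | order =>
    refine ⟨fun _ => 3, 1, Primrec.const _, fun I m ρ hm ho _ _ => ⟨?_, ?_⟩⟩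
    · simp only [Tm.eval, Tm.large, cond_true, pow_one]; omega
    · exact le_mul_pow_of_le (by simp [Tm.cost]) hm
  | par =>
    refine ⟨fun d => d + 6, 0, primrec_add Primrec.id (Primrec.const _),
      fun I m ρ hm _ _ _ => ⟨?_, ?_⟩⟩
    · exact le_mul_pow_of_le (by simp [Tm.eval]) hm
    · exact le_mul_pow_of_le (by simp [Tm.cost]) hm
  | entry e ih =>
    obtain ⟨g, c', hg, h⟩ := ih Γ hok f hf c
    refine ⟨fun d => g d + 5, c', primrec_add hg (Primrec.const _),
      fun I m ρ hm ho he hρ => ⟨?_, ?_⟩⟩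
    · exact le_mul_pow_of_le ((he _).trans (by dsimp only; omega)) hm
    · have := (h I m ρ hm ho he hρ).2
      simp only [Tm.cost, add_mul]
      exact add_le_add this (le_mul_pow_of_le le_rfl hm)
  | add a b iha ihb =>
    simp only [Tm.ok, Bool.and_eq_true] at hok
    obtain ⟨g₁, c₁, hg₁, h₁⟩ := iha Γ hok.1 f hf c
    obtain ⟨g₂, c₂, hg₂, h₂⟩ := ihb Γ hok.2 f hf c
    refine ⟨fun d => g₁ d + g₂ d + 4, c₁ + c₂,
      primrec_add (primrec_add hg₁ hg₂) (Primrec.const _), fun I m ρ hm ho he hρ => ?_⟩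
    obtain ⟨v₁, t₁⟩ := h₁ I m ρ hm ho he hρ
    obtain ⟨v₂, t₂⟩ := h₂ I m ρ hm ho he hρ
    simp only [Tm.eval, Tm.cost, add_mul]
    refine ⟨Nat.le_add_right_of_le (add_le_add (le_mul_pow_mono v₁ hm le_rfl ?_)
      (le_mul_pow_mono v₂ hm le_rfl ?_)), add_le_add (add_le_add
      (le_mul_pow_mono t₁ hm le_rfl (by omega)) (le_mul_pow_mono t₂ hm le_rfl (by omega)))
      (le_mul_pow_of_le le_rfl hm)⟩
    all_goals
      simp only [Tm.large]
      cases a.large Γ <;> cases b.large Γ <;> simp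
  | sub a b iha ihb =>
    simp only [Tm.ok, Bool.and_eq_true] at hok
    obtain ⟨g₁, c₁, hg₁, h₁⟩ := iha Γ hok.1 f hf c
    obtain ⟨g₂, c₂, hg₂, h₂⟩ := ihb Γ hok.2 f hf c
    refine ⟨fun d => g₁ d + g₂ d + 4, c₁ + c₂,
      primrec_add (primrec_add hg₁ hg₂) (Primrec.const _), fun I m ρ hm ho he hρ => ?_⟩
    obtain ⟨v₁, t₁⟩ := h₁ I m ρ hm ho he hρ
    obtain ⟨v₂, t₂⟩ := h₂ I m ρ hm ho he hρ
    refine ⟨le_mul_pow_mono ((Nat.sub_le _ _).trans v₁) hm (by dsimp only; omega) ?_, ?_⟩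
    · simp only [Tm.large]
      cases a.large Γ <;> simp
    · simp only [Tm.cost, add_mul]
      exact add_le_add (add_le_add (le_mul_pow_mono t₁ hm le_rfl (by omega))
        (le_mul_pow_mono t₂ hm le_rfl (by omega))) (le_mul_pow_of_le le_rfl hm)
  | mul a b iha ihb =>
    simp only [Tm.ok, Bool.and_eq_true] at hok
    obtain ⟨g₁, c₁, hg₁, h₁⟩ := iha Γ hok.1 f hf c
    obtain ⟨g₂, c₂, hg₂, h₂⟩ := ihb Γ hok.2 f hf c
    refine ⟨fun d => g₁ d * g₂ d + (g₁ d + g₂ d + g₁ d * 10 + 4), c₁ + c₂,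
      primrec_add (primrec_mul hg₁ hg₂) (primrec_add (primrec_add (primrec_add hg₁ hg₂)
        (primrec_mul hg₁ (Primrec.const _))) (Primrec.const _)), fun I m ρ hm ho he hρ => ?_⟩
    obtain ⟨v₁, t₁⟩ := h₁ I m ρ hm ho he hρ
    obtain ⟨v₂, t₂⟩ := h₂ I m ρ hm ho he hρ
    constructor
    · refine le_mul_pow_mono (e := cond (a.large Γ) c₁ 0 + cond (b.large Γ) c₂ 0)
        (g := g₁ I.par * g₂ I.par) ?_ hm (by dsimp only; omega) ?_
      · rw [pow_add, mul_mul_mul_comm]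
        exact Nat.mul_le_mul v₁ v₂
      · simp only [Tm.large]
        cases a.large Γ <;> cases b.large Γ <;> simp
    · have v₁' : a.eval I ρ ≤ g₁ I.par * m ^ (c₁ + c₂) :=
        le_mul_pow_mono v₁ hm le_rfl (by cases a.large Γ <;> simp)
      have t₁' := le_mul_pow_mono t₁ hm le_rfl (Nat.le_add_right c₁ c₂)
      have t₂' := le_mul_pow_mono t₂ hm le_rfl (Nat.le_add_left c₂ c₁)
      have h4 : 4 ≤ 4 * m ^ (c₁ + c₂) := le_mul_pow_of_le le_rfl hm
      refine le_trans ?_ (Nat.mul_le_mul_right _ (Nat.le_add_left _ _))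
      simp only [Tm.cost]
      linarith
  | pow2 a iha =>
    simp only [Tm.ok, Bool.and_eq_true, Bool.not_eq_true'] at hok
    obtain ⟨g₁, c₁, hg₁, h₁⟩ := iha Γ hok.1 f hf c
    refine ⟨fun d => 2 ^ g₁ d + (g₁ d + g₁ d * 10 + 4), c₁, primrec_add (primrec_two_pow hg₁)
      (primrec_add (primrec_add hg₁ (primrec_mul hg₁ (Primrec.const _))) (Primrec.const _)),
      fun I m ρ hm ho he hρ => ?_⟩
    obtain ⟨v₁, t₁⟩ := h₁ I m ρ hm ho he hρ
    rw [hok.2] at v₁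
    simp only [cond_false, pow_zero, mul_one] at v₁
    constructor
    · exact le_mul_pow_of_le ((Nat.pow_le_pow_right (by omega) v₁).trans (Nat.le_add_right _ _)) hm
    · have v₁' : a.eval I ρ ≤ g₁ I.par * m ^ c₁ := le_mul_pow_of_le v₁ hm
      have h4 : 4 ≤ 4 * m ^ c₁ := le_mul_pow_of_le le_rfl hm
      refine le_trans ?_ (Nat.mul_le_mul_right _ (Nat.le_add_left _ _))
      simp only [Tm.cost]
      linarith
  | sum a b iha ihb =>
    simp only [Tm.ok, Bool.and_eq_true] at hok
    obtain ⟨g₁, c₁, hg₁, h₁⟩ := iha Γ hok.1 f hf c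
    obtain ⟨g₂, c₂, hg₂, h₂⟩ := ihb _ hok.2 (fun d => f d + g₁ d) (primrec_add hf hg₁) (c + c₁)
    refine ⟨fun d => g₁ d * (g₂ d + 12) + (g₁ d + 8), c₁ + c₂, primrec_add (primrec_mul hg₁
      (primrec_add hg₂ (Primrec.const _))) (primrec_add hg₁ (Primrec.const _)),
      fun I m ρ hm ho he hρ => ?_⟩
    obtain ⟨v₁, t₁⟩ := h₁ I m ρ hm ho he hρ
    have key : ∀ i < a.eval I ρ, _ := fun i hi => h₂ I m (extend i ρ) hm ho he (fun j => by
      cases j with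
      | zero => exact le_mul_pow_mono (hi.le.trans v₁) hm (by omega)
                  (by simp only [extend]; cases a.large Γ <;> simp)
      | succ j => exact le_mul_pow_mono (hρ j) hm (by omega)
                    (by simp only [extend]; cases Γ j <;> simp))
    simp only [Tm.eval, Tm.cost]
    constructor
    · refine le_mul_pow_mono
        (e := cond (a.large Γ) c₁ 0 + cond (b.large (extend (a.large Γ) Γ)) c₂ 0)
        (g := g₁ I.par * g₂ I.par) ?_ hm (by rw [mul_add]; omega) ?_
      · rw [pow_add, mul_mul_mul_comm]
        refine le_trans (Finset.sum_le_card_nsmul _ _ _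
          fun i hi => (key i (Finset.mem_range.1 hi)).1) ?_
        rw [Finset.card_range, smul_eq_mul]
        exact Nat.mul_le_mul_right _ v₁
      · simp only [Tm.large]
        cases a.large Γ <;> cases b.large (extend _ Γ) <;> simp
    · have hs : ∑ i ∈ Finset.range (a.eval I ρ), (b.cost I (extend i ρ) + 12) ≤
          g₁ I.par * (g₂ I.par + 12) * m ^ (c₁ + c₂) := by
        rw [pow_add, mul_mul_mul_comm]
        refine le_trans (Finset.sum_le_card_nsmul _ _ ((g₂ I.par + 12) * m ^ c₂)
          fun i hi => ?_) ?_
        · rw [add_mul]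
          exact add_le_add (key i (Finset.mem_range.1 hi)).2 (le_mul_pow_of_le le_rfl hm)
        · rw [Finset.card_range, smul_eq_mul]
          exact Nat.mul_le_mul_right _ (le_mul_pow_mono v₁ hm le_rfl
            (by cases a.large Γ <;> simp))
      have t₁' := le_mul_pow_mono t₁ hm le_rfl (Nat.le_add_right c₁ c₂)
      have h8 : 8 ≤ 8 * m ^ (c₁ + c₂) := le_mul_pow_of_le le_rfl hm
      linarith
  | call f' a b c' ihf iha ihb ihc =>
    simp only [Tm.ok, Bool.and_eq_true] at hok
    obtain ⟨g₁, c₁, hg₁, h₁⟩ := iha Γ hok.1.1.1 f hf c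
    obtain ⟨g₂, c₂, hg₂, h₂⟩ := ihb Γ hok.1.1.2 f hf c
    obtain ⟨g₃, c₃, hg₃, h₃⟩ := ihc Γ hok.1.2 f hf c
    obtain ⟨g, C, hg, h⟩ := ihf _ hok.2 (fun d => g₁ d + g₂ d + g₃ d)
      (primrec_add (primrec_add hg₁ hg₂) hg₃) (c₁ + c₂ + c₃)
    refine ⟨fun d => g₁ d + g₂ d + g₃ d + g d + 2, c₁ + c₂ + c₃ + C, primrec_add (primrec_add
      (primrec_add (primrec_add hg₁ hg₂) hg₃) hg) (Primrec.const _), fun I m ρ hm ho he hρ => ?_⟩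
    obtain ⟨v₁, t₁⟩ := h₁ I m ρ hm ho he hρ
    obtain ⟨v₂, t₂⟩ := h₂ I m ρ hm ho he hρ
    obtain ⟨v₃, t₃⟩ := h₃ I m ρ hm ho he hρ
    obtain ⟨v, t⟩ := h I m (args (a.eval I ρ) (b.eval I ρ) (c'.eval I ρ)) hm ho he (fun j => by
      match j with
      | 0 => exact le_mul_pow_mono v₁ hm (by omega)
              (by simp only [args]; cases a.large Γ <;> simp; omega)
      | 1 => exact le_mul_pow_mono v₂ hm (by omega)
              (by simp only [args]; cases b.large Γ <;> simp; omega)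
      | _ + 2 => exact le_mul_pow_mono v₃ hm (by omega)
                  (by simp only [args]; cases c'.large Γ <;> simp))
    simp only [Tm.eval, Tm.cost, Tm.large]
    constructor
    · exact le_mul_pow_mono v hm (by omega) (by cases f'.large _ <;> simp)
    · simp only [add_mul]
      exact add_le_add (add_le_add (add_le_add (add_le_add
        (le_mul_pow_mono t₁ hm le_rfl (by omega)) (le_mul_pow_mono t₂ hm le_rfl (by omega)))
        (le_mul_pow_mono t₃ hm le_rfl (by omega))) (le_mul_pow_mono t hm le_rfl (by omega)))
        (le_mul_pow_of_le le_rfl hm)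

/-- What the machine sees of an instance with the adjacency relation `r`. -/
noncomputable def inputOf (n k : ℕ) (r : Fin n → Fin n → Prop) : Input where
  order := n
  par := n - k
  entry i := (graphCode n k r).getD (i + 2) 0

theorem entry_inputOf (n k : ℕ) (r : Fin n → Fin n → Prop) (u v : Fin n) :
    (inputOf n k r).entry (u * n + v) = 1 ∧ r u v ∨
      (inputOf n k r).entry (u * n + v) = 0 ∧ ¬ r u v := by
  have h : (u : ℕ) * n + v < n * n := by nlinarith [u.2, v.2]
  have e₁ : (⟨u * n + v, h⟩ : Fin (n * n)).divNat = u := by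
    ext
    simp [Fin.divNat, Nat.add_div_of_dvd_right, Nat.mul_div_cancel u.1 u.pos]
  have e₂ : (⟨u * n + v, h⟩ : Fin (n * n)).modNat = v := by
    ext
    simp [Fin.modNat, Nat.mod_eq_of_lt]
  have : (inputOf n k r).entry (u * n + v) = open Classical in if r u v then 1 else 0 := by
    simp only [inputOf, graphCode, List.getD_cons_succ]
    simp only [List.getD, List.getElem?_ofFn, h, dite_true, Option.getD_some]
    classical exact if_congr (by rw [e₁, e₂]) rfl rfl
  rw [this]
  by_cases hr : r u v <;> simp [hr]

theorem entry_inputOf_le (n k : ℕ) (r : Fin n → Fin n → Prop) (i : ℕ) :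
    (inputOf n k r).entry i ≤ 1 := by
  simp only [inputOf, graphCode, List.getD_cons_succ]
  by_cases h : i < n * n
  · simp only [List.getD, List.getElem?_ofFn, h, dite_true, Option.getD_some]
    split_ifs <;> simp
  · simp [List.getD, h]

theorem order_le_inputSize (n k : ℕ) (r : Fin n → Fin n → Prop) :
    n ≤ inputSize (graphCode n k r) := by
  have h : ∀ w : List ℕ, w.length ≤ inputSize w := fun w => by
    induction w with
    | nil => simp
    | cons a w ih => simp [inputSize] at ih ⊢; omega
  refine le_trans ?_ (h _)
  simp only [graphCode, List.length_cons, List.length_ofFn]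
  nlinarith [Nat.le_mul_self n]

/-- A problem is fixed-parameter tractable if it is decided by a closed term whose exponents are
bounded in terms of the parameter. -/
theorem isFPT_of_term (P : ParamProblem) (n k : P.Inst → ℕ)
    (r : (x : P.Inst) → Fin (n x) → Fin (n x) → Prop)
    (hcode : ∀ x, P.code x = graphCode (n x) (k x) (r x)) (hpar : ∀ x, P.param x = n x - k x)
    (e : Tm) (hok : e.ok (fun _ => false) = true)
    (he : ∀ x, e.eval (inputOf (n x) (k x) (r x)) (fun _ => 0) ≠ 0 ↔ P.yes x) : P.IsFPT := by
  obtain ⟨g, c, hg, h⟩ := e.bound _ hok (fun _ => 0) (Primrec.const 0) 0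
  refine ⟨.seq (e.compile (fun _ => 1) 2) (.assign 0 (.reg 2)), fun d => g d + 2, c,
    (primrec_add hg (Primrec.const _)).to_comp, fun x => ?_⟩
  obtain ⟨s, hs, -, hv⟩ := e.compile_runs (inputOf (n x) (k x) (r x)) (fun _ => 1) 2 (fun _ => 0)
    (initState (P.code x)) (by
      rw [hcode]
      exact ⟨by simp [initState, graphCode, inputOf], by simp [initState, graphCode, inputOf],
        fun i => by simp [initState, inputOf]⟩) (by simp) (by simp [initState])
  have hm : 1 ≤ inputSize (P.code x) := by simp [inputSize]
  refine ⟨_, _, Runs.seq hs (Runs.assign_set _ _ _), ?_, ?_⟩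
  · have := (h (inputOf (n x) (k x) (r x)) (inputSize (P.code x)) (fun _ => 0) hm
      (by rw [hcode]; exact order_le_inputSize _ _ _) (entry_inputOf_le _ _ _) (by simp)).2
    rw [add_mul, hpar]
    exact add_le_add this (le_mul_pow_of_le le_rfl hm)
  · rw [← he]
    simp [Expr.eval, hv]

/-! ### Packings of paths -/

/-- The properties that the three kinds of paths have in common, for a fixed graph: subpaths, single
vertices and single arcs are of the kind, and automorphisms preserve the kind. -/
structure IsPathKind {V : Type} (r : V → V → Prop) (Q : List V → Prop) : Prop where
  isPath : ∀ {p}, Q p → IsPath r p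
  single : ∀ v, Q [v]
  arc : ∀ {u v}, r u v → Q [u, v]
  take : ∀ {p} (j : ℕ), Q p → Q (p.take (j + 1))
  map : ∀ {p} (σ : Equiv.Perm V), (∀ a b, r (σ a) (σ b) ↔ r a b) → Q p → Q (p.map σ)

section Kinds

variable {V : Type} {r : V → V → Prop}

theorem IsPath.take {p : List V} (h : IsPath r p) (j : ℕ) : IsPath r (p.take (j + 1)) :=
  ⟨by simp [h.1], h.2.1.sublist (List.take_sublist _ _), h.2.2.take _⟩

theorem IsPath.map {p : List V} (h : IsPath r p) (σ : Equiv.Perm V)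
    (hσ : ∀ a b, r (σ a) (σ b) ↔ r a b) : IsPath r (p.map σ) :=
  ⟨by simp [h.1], h.2.1.map σ.injective, by
    rw [List.isChain_map]
    exact h.2.2.imp fun a b => (hσ a b).2⟩

theorem isPath_single (v : V) : IsPath r [v] := by simp [IsPath]

theorem isPath_arc (hr : ∀ v, ¬ r v v) {u v : V} (h : r u v) : IsPath r [u, v] := by
  have : u ≠ v := fun e => hr v (e ▸ h)
  simp [IsPath, this, h]

theorem isPathKind_isPath (hr : ∀ v, ¬ r v v) : IsPathKind r (IsPath r) :=
  ⟨id, isPath_single, isPath_arc hr, fun j h => h.take j, fun σ hσ h => h.map σ hσ⟩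

theorem isPathKind_isInducedPath (hr : ∀ v, ¬ r v v) : IsPathKind r (IsInducedPath r) := by
  refine ⟨fun h => h.1, fun v => ⟨isPath_single v, ?_⟩, fun h => ⟨isPath_arc hr h, ?_⟩,
    fun {p} j h => ⟨h.1.take j, fun a b hab => ?_⟩,
    fun {p} σ hσ h => ⟨h.1.map σ hσ, fun a b hab => ?_⟩⟩
  · intro i j hij
    simp [hr] at hij
  · intro i j hij
    have hne : i ≠ j := by
      rintro rfl
      exact hr _ hij
    have := i.2
    have := j.2
    simp only [List.length_cons, List.length_nil] at this ‹i.val < _›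
    have : i.val ≠ j.val := fun e => hne (Fin.ext e)
    omega
  · have ha := a.2
    have hb := b.2
    simp only [List.length_take, lt_inf_iff] at ha hb
    exact h.2 ⟨a, ha.2⟩ ⟨b, hb.2⟩ (by simpa using hab)
  · have ha := a.2
    have hb := b.2
    simp only [List.length_map] at ha hb
    exact h.2 ⟨a, ha⟩ ⟨b, hb⟩ (by simpa [hσ] using hab)

/-- A walk contains a path between its ends: cut out the closed parts, starting from the last
vertex. -/
theorem exists_isPath_of_isChain (q : List V) (hq : q ≠ []) (hc : q.IsChain r) :
    ∃ q', IsPath r q' ∧ q'.head? = q.head? ∧ q'.getLast? = q.getLast? ∧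
      q'.length ≤ q.length := by
  induction q with
  | nil => exact absurd rfl hq
  | cons a l ih =>
    rcases l with _ | ⟨b, l⟩
    · exact ⟨[a], isPath_single a, rfl, rfl, le_rfl⟩
    · obtain ⟨q', hp, hh, hl, hlen⟩ := ih (by simp) hc.tail
      by_cases ha : a ∈ q'
      · obtain ⟨s, t, rfl⟩ := List.append_of_mem ha
        refine ⟨a :: t, ⟨by simp, (List.nodup_append.1 hp.2.1).2.1,
          hp.2.2.right_of_append⟩, rfl, ?_, ?_⟩
        · rw [List.getLast?_cons_cons, ← hl, List.getLast?_append_of_ne_nil _ (by simp)]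
        · simp only [List.length_append, List.length_cons] at hlen ⊢
          omega
      · obtain ⟨c, t, rfl⟩ := List.exists_cons_of_ne_nil hp.1
        simp only [List.head?_cons, Option.some.injEq] at hh
        subst hh
        refine ⟨a :: c :: t, ⟨by simp, List.nodup_cons.2 ⟨ha, hp.2.1⟩, ?_⟩, rfl, ?_, ?_⟩
        · rw [List.isChain_cons_cons] at hc ⊢
          exact ⟨hc.1, hp.2.2⟩
        · rw [List.getLast?_cons_cons, List.getLast?_cons_cons, hl]
        · simpa using hlen

theorem isPathKind_isShortestPath (hr : ∀ v, ¬ r v v) : IsPathKind r (IsShortestPath r) := by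
  refine ⟨fun h => h.1, fun v => ⟨isPath_single v, fun q hq _ _ => ?_⟩,
    fun {u v} h => ⟨isPath_arc hr h, fun q hq hh hl => ?_⟩,
    fun {p} j h => ⟨h.1.take j, fun q hq hh hl => ?_⟩,
    fun {p} σ hσ h => ⟨h.1.map σ hσ, fun q hq hh hl => ?_⟩⟩
  · exact List.length_pos_iff.2 hq.1
  · have huv : u ≠ v := fun e => hr v (e ▸ h)
    match q with
    | [] => exact absurd rfl hq.1
    | [a] => exact absurd (by simp_all) huv
    | _ :: _ :: _ => simp
  · by_contra! hlt
    -- Otherwise, replacing the initial segment of `p` by `q` gives a walk shorter than `p`.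
    by_cases hj : p.length ≤ j + 1
    · rw [List.take_of_length_le hj] at hh hl hlt
      exact absurd (h.2 q hq hh hl) (by omega)
    push Not at hj
    have hp0 := h.1.1
    have hd : p.drop (j + 1) ≠ [] := by simpa using hj
    obtain ⟨q', hp', hh', hl', hlen⟩ := exists_isPath_of_isChain (q ++ p.drop (j + 1))
      (by simp [hq.1]) (by
        have := h.1.2.2
        rw [← List.take_append_drop (j + 1) p, List.isChain_append] at this
        rw [List.isChain_append]
        refine ⟨hq.2.2, this.2.1, ?_⟩
        rw [hl]
        exact this.2.2)
    have := h.2 q' hp' (by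
        rw [hh', List.head?_append_of_ne_nil _ hq.1, hh, List.head?_take, if_neg (by omega)]) (by
        rw [hl', List.getLast?_append_of_ne_nil _ hd]
        conv_rhs => rw [← List.take_append_drop (j + 1) p]
        rw [List.getLast?_append_of_ne_nil _ hd])
    simp only [List.length_append, List.length_drop, List.length_take] at hlen hlt
    omega
  · have hσ' : ∀ a b, r (σ.symm a) (σ.symm b) ↔ r a b := fun a b => by
      rw [← hσ]
      simp
    have := h.2 (q.map σ.symm) (hq.map σ.symm hσ') (by simp [hh, Function.comp_def])
      (by simp [hl, Function.comp_def])
    simpa using this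

end Kinds

/-- A packing: a family of pairwise disjoint paths of the kind `Q`. -/
def IsPacking {V : Type} (Q : List V → Prop) (Ps : List (List V)) : Prop :=
  (∀ P ∈ Ps, Q P) ∧ Ps.flatten.Nodup

/-- The total number of edges of a family of paths. -/
def edgeCount {V : Type} (Ps : List (List V)) : ℕ := (Ps.map fun P => P.length - 1).sum

section Packings

variable {V : Type} {r : V → V → Prop} {Q : List V → Prop}

theorem length_flatten_eq (Ps : List (List V)) (h : ∀ P ∈ Ps, P ≠ []) :
    Ps.flatten.length = edgeCount Ps + Ps.length := by
  induction Ps with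
  | nil => rfl
  | cons P Ps ih =>
    have h1 := List.length_pos_iff.2 (h P (by simp))
    have h2 := ih fun P hP => h P (by simp [hP])
    simp only [edgeCount, List.flatten_cons, List.length_append, List.map_cons, List.sum_cons,
      List.length_cons] at h2 ⊢
    omega

/-- At most `k` paths suffice if and only if some packing has `n - k` edges: a packing with that
many edges is completed by single vertices. -/
theorem hasPartition_iff_packing [Fintype V] (hQ : IsPathKind r Q) (k : ℕ) :
    HasPartition Q k ↔ ∃ Ps, IsPacking Q Ps ∧ Fintype.card V - k ≤ edgeCount Ps := by
  classical
  constructor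
  · rintro ⟨Ps, hk, hPs, hd, hc⟩
    refine ⟨Ps, ⟨hPs, List.nodup_flatten.2 ⟨fun P hP => (hQ.isPath (hPs P hP)).2.1, hd⟩⟩, ?_⟩
    have h1 := length_flatten_eq Ps fun P hP => (hQ.isPath (hPs P hP)).1
    have h2 : Fintype.card V ≤ Ps.flatten.length := by
      refine le_trans ?_ (List.toFinset_card_le _)
      refine Finset.card_le_card fun v _ => ?_
      simpa using hc v
    omega
  · rintro ⟨Ps, ⟨hPs, hd⟩, hk⟩
    have h1 := length_flatten_eq Ps fun P hP => (hQ.isPath (hPs P hP)).1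
    refine ⟨Ps ++ (Finset.univ \ Ps.flatten.toFinset).toList.map fun v => [v], ?_, ?_, ?_, ?_⟩
    · rw [List.length_append, List.length_map, Finset.length_toList,
        Finset.card_sdiff_of_subset (Finset.subset_univ _), List.toFinset_card_of_nodup hd,
        Finset.card_univ]
      have := hd.length_le_card
      omega
    · intro P hP
      rcases List.mem_append.1 hP with hP | hP
      · exact hPs P hP
      · obtain ⟨v, -, rfl⟩ := List.mem_map.1 hP
        exact hQ.single v
    · refine List.pairwise_append.2 ⟨(List.nodup_flatten.1 hd).2, ?_, ?_⟩
      · rw [List.pairwise_map]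
        exact (Finset.nodup_toList _).imp fun h => by simpa using h.symm
      · intro P hP P' hP'
        obtain ⟨v, hv, rfl⟩ := List.mem_map.1 hP'
        simp only [Finset.mem_toList, Finset.mem_sdiff, Finset.mem_univ, true_and,
          List.mem_toFinset, List.mem_flatten, not_exists, not_and] at hv
        simpa using hv P hP
    · intro v
      by_cases hv : v ∈ Ps.flatten
      · obtain ⟨P, hP, hvP⟩ := List.mem_flatten.1 hv
        exact ⟨P, by simp [hP], hvP⟩
      · refine ⟨[v], List.mem_append_right _ (List.mem_map.2 ⟨v, ?_, rfl⟩), by simp⟩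
        simpa using hv

/-- A packing can be shortened to have exactly `d` edges, and no single vertices. -/
theorem IsPacking.exists_edgeCount_eq (hQ : IsPathKind r Q) {Ps : List (List V)}
    (h : IsPacking Q Ps) (d : ℕ) (hd : d ≤ edgeCount Ps) :
    ∃ Ps', IsPacking Q Ps' ∧ edgeCount Ps' = d ∧ (∀ P ∈ Ps', 2 ≤ P.length) ∧
      Ps'.flatten ⊆ Ps.flatten := by
  induction Ps generalizing d with
  | nil => exact ⟨[], h, (Nat.le_zero.1 hd).symm, by simp, by simp⟩
  | cons P Ps ih =>
    have h2 := List.nodup_append.1 h.2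
    have hPs : IsPacking Q Ps := ⟨fun P' hP' => h.1 P' (by simp [hP']), h2.2.1⟩
    by_cases hd' : d ≤ edgeCount Ps
    · obtain ⟨Ps', h1, h2, h3, h4⟩ := ih hPs d hd'
      exact ⟨Ps', h1, h2, h3, fun v hv => List.mem_append_right _ (h4 hv)⟩
    -- All edges of `Ps` are needed; the missing ones are taken from an initial segment of `P`.
    · obtain ⟨Ps', i1, i2, i3, i4⟩ := ih hPs _ le_rfl
      have hd2 : d ≤ P.length - 1 + edgeCount Ps := hd
      have hlen : (P.take (d - edgeCount Ps + 1)).length = d - edgeCount Ps + 1 := by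
        rw [List.length_take]
        omega
      refine ⟨P.take (d - edgeCount Ps + 1) :: Ps', ⟨?_, ?_⟩, ?_, ?_, ?_⟩
      · intro P' hP'
        rcases List.mem_cons.1 hP' with rfl | hP'
        · exact hQ.take _ (h.1 P (by simp))
        · exact i1.1 P' hP'
      · rw [List.flatten_cons]
        exact List.nodup_append.2 ⟨h2.1.sublist (List.take_sublist _ _), i1.2,
          fun a ha b hb => h2.2.2 a (List.mem_of_mem_take ha) b (i4 hb)⟩
      · show (P.take _).length - 1 + edgeCount Ps' = d
        omega
      · intro P' hP'
        rcases List.mem_cons.1 hP' with rfl | hP'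
        · omega
        · exact i3 P' hP'
      · intro v hv
        rw [List.flatten_cons, List.mem_append] at hv ⊢
        exact hv.imp List.mem_of_mem_take fun h => i4 h

theorem length_le_edgeCount {Ps : List (List V)} (h : ∀ P ∈ Ps, 2 ≤ P.length) :
    Ps.length ≤ edgeCount Ps := by
  induction Ps with
  | nil => simp
  | cons P Ps ih =>
    have h1 := h P (by simp)
    have h2 := ih fun P hP => h P (by simp [hP])
    simp only [edgeCount, List.map_cons, List.sum_cons, List.length_cons] at h2 ⊢
    omega

theorem length_le_edgeCount_succ {Ps : List (List V)} {P : List V} (h : P ∈ Ps) :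
    P.length ≤ edgeCount Ps + 1 := by
  have := List.single_le_sum (l := Ps.map fun P => P.length - 1) (by simp) (P.length - 1)
    (List.mem_map.2 ⟨P, h, rfl⟩)
  unfold edgeCount
  omega

/-- Greedy choice of disjoint arcs: there are `j` of them, or few vertices meet all arcs. -/
theorem exists_packing_or_cover (hQ : IsPathKind r Q) (hr : ∀ v, ¬ r v v) (j : ℕ) :
    (∃ Ps, IsPacking Q Ps ∧ edgeCount Ps = j ∧ Ps.flatten.length = 2 * j) ∨
      ∃ X : Finset V, X.card ≤ 2 * j ∧ ∀ u v, r u v → u ∈ X ∨ v ∈ X := by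
  classical
  induction j with
  | zero => exact Or.inl ⟨[], by simp [IsPacking], rfl, rfl⟩
  | succ j ih =>
    rcases ih with ⟨Ps, h1, h2, h3⟩ | ⟨X, hX, hc⟩
    · by_cases hc : ∀ u v, r u v → u ∈ Ps.flatten.toFinset ∨ v ∈ Ps.flatten.toFinset
      · exact Or.inr ⟨_, (List.toFinset_card_le _).trans (by omega), hc⟩
      · push Not at hc
        obtain ⟨u, v, huv, hu, hv⟩ := hc
        rw [List.mem_toFinset] at hu hv
        have hne : u ≠ v := fun e => hr v (e ▸ huv)
        refine Or.inl ⟨[u, v] :: Ps, ⟨?_, ?_⟩, ?_, ?_⟩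
        · intro P hP
          rcases List.mem_cons.1 hP with rfl | hP
          · exact hQ.arc huv
          · exact h1.1 P hP
        · rw [List.flatten_cons, List.cons_append, List.cons_append, List.nil_append]
          simp only [List.nodup_cons, List.mem_cons, not_or]
          exact ⟨⟨hne, hu⟩, hv, h1.2⟩
        · simp only [edgeCount, List.map_cons, List.sum_cons, List.length_cons,
            List.length_nil] at h2 ⊢
          omega
        · simp only [List.flatten_cons, List.length_append, List.length_cons, List.length_nil]
          omega
    · exact Or.inr ⟨X, by omega, hc⟩

end Packings

/-! ### Twins -/

section Twins

variable {n : ℕ} {r : Fin n → Fin n → Prop}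

/-- Two vertices with the same in- and out-neighbours. -/
def Twin (r : Fin n → Fin n → Prop) (u v : Fin n) : Prop := ∀ w, (r u w ↔ r v w) ∧ (r w u ↔ r w v)

theorem Twin.swap_iff {u v : Fin n} (h : Twin r u v) (a b : Fin n) :
    r (Equiv.swap u v a) (Equiv.swap u v b) ↔ r a b := by
  have h1 := fun w => (h w).1
  have h2 := fun w => (h w).2
  rw [Equiv.swap_apply_def, Equiv.swap_apply_def]
  split_ifs <;> subst_vars <;> simp_all

open Classical in
/-- The vertices that have fewer than `2 * d` twins before them. -/
noncomputable def core (r : Fin n → Fin n → Prop) (d : ℕ) : Finset (Fin n) :=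
  Finset.univ.filter fun v => (Finset.univ.filter fun u => u < v ∧ Twin r u v).card < 2 * d

/-- A few vertices can be moved into the core by an automorphism that fixes those that are in the
core already: while some vertex is not in the core, exchange it with an earlier twin that is not
among the given vertices. -/
theorem exists_automorphism (d : ℕ) (S : Finset (Fin n)) (hS : S.card ≤ 2 * d) :
    ∃ σ : Equiv.Perm (Fin n), (∀ a b, r (σ a) (σ b) ↔ r a b) ∧ (∀ v ∈ S, σ v ∈ core r d) ∧
      ∀ v ∈ S, v ∈ core r d → σ v = v := by
  classical
  induction hm : ∑ v ∈ S, v.val using Nat.strong_induction_on generalizing S with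
  | _ m ih =>
    by_cases hc : ∀ v ∈ S, v ∈ core r d
    · exact ⟨1, by simp, by simpa using hc, by simp⟩
    push Not at hc
    obtain ⟨v, hvS, hv⟩ := hc
    obtain ⟨u, hu, huS⟩ : ∃ u, (u < v ∧ Twin r u v) ∧ u ∉ S := by
      by_contra! hcon
      refine hv (Finset.mem_filter.2 ⟨Finset.mem_univ _, lt_of_lt_of_le
        (Finset.card_lt_card (t := S) (Finset.ssubset_iff_subset_ne.2 ⟨fun u hu => ?_, ?_⟩)) hS⟩)
      · exact hcon u (Finset.mem_filter.1 hu).2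
      · intro e
        rw [← e] at hvS
        exact lt_irrefl _ (Finset.mem_filter.1 hvS).2.1
    have hsum : ∑ w ∈ insert u (S.erase v), w.val < m := by
      rw [Finset.sum_insert (fun h => huS (Finset.mem_of_mem_erase h)), ← hm,
        ← Finset.add_sum_erase S _ hvS]
      have : u.val < v.val := hu.1
      omega
    obtain ⟨σ, h1, h2, h3⟩ := ih _ hsum (insert u (S.erase v)) (by
      rw [Finset.card_insert_of_notMem (fun h => huS (Finset.mem_of_mem_erase h)),
        Finset.card_erase_of_mem hvS]
      have := Finset.card_pos.2 ⟨v, hvS⟩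
      omega) rfl
    refine ⟨σ * Equiv.swap u v, fun a b => ?_, fun w hw => ?_, fun w hw hwc => ?_⟩
    · rw [Equiv.Perm.mul_apply, Equiv.Perm.mul_apply, h1, hu.2.swap_iff]
    · rw [Equiv.Perm.mul_apply]
      by_cases hwv : w = v
      · subst hwv
        rw [Equiv.swap_apply_right]
        exact h2 u (Finset.mem_insert_self _ _)
      · have hwu : w ≠ u := fun e => huS (e ▸ hw)
        rw [Equiv.swap_apply_of_ne_of_ne hwu hwv]
        exact h2 w (Finset.mem_insert_of_mem (Finset.mem_erase.2 ⟨hwv, hw⟩))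
    · have hwv : w ≠ v := fun e => hv (e ▸ hwc)
      have hwu : w ≠ u := fun e => huS (e ▸ hw)
      rw [Equiv.Perm.mul_apply, Equiv.swap_apply_of_ne_of_ne hwu hwv]
      exact h3 w (Finset.mem_insert_of_mem (Finset.mem_erase.2 ⟨hwv, hw⟩)) hwc

/-- Outside of a vertex cover `X`, vertices with the same neighbours in `X` are twins. So there are
at most `4 ^ |X|` classes of twins, and each meets the core in at most `2 * d` vertices. -/
theorem card_core_le (d : ℕ) (X : Finset (Fin n)) (hX : ∀ u v, r u v → u ∈ X ∨ v ∈ X) :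
    (core r d).card ≤ X.card + 2 * d * (2 ^ X.card * 2 ^ X.card) := by
  classical
  have hsplit : (core r d).card ≤ X.card + (core r d \ X).card := by
    refine le_trans (Finset.card_le_card (t := X ∪ (core r d \ X)) ?_) (Finset.card_union_le _ _)
    simp
  refine hsplit.trans (Nat.add_le_add_left ?_ _)
  refine (Finset.card_le_mul_card_image (f := fun v => (X.filter (r v), X.filter fun w => r w v))
    _ (2 * d) fun c _ => ?_).trans (Nat.mul_le_mul_left _ ?_)
  · set F := (core r d \ X).filter fun v => (X.filter (r v), X.filter fun w => r w v) = c with hF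
    rcases F.eq_empty_or_nonempty with h0 | hne
    · simp [h0]
    have htwin : ∀ u ∈ F, ∀ v ∈ F, Twin r u v := by
      intro u hu v hv w
      simp only [hF, Finset.mem_filter, Finset.mem_sdiff] at hu hv
      have he := hu.2.trans hv.2.symm
      rw [Prod.mk.injEq] at he
      have e1 := Finset.ext_iff.1 he.1 w
      have e2 := Finset.ext_iff.1 he.2 w
      rw [Finset.mem_filter, Finset.mem_filter] at e1 e2
      have hin : ∀ x ∉ X, (r x w → w ∈ X) ∧ (r w x → w ∈ X) := fun x hx =>
        ⟨fun h => (hX x w h).resolve_left hx, fun h => (hX w x h).resolve_right hx⟩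
      have hu' := hin u hu.1.2
      have hv' := hin v hv.1.2
      clear hu hv he hin hsplit hF hne hX
      tauto
    -- The last vertex of the class `F` has all the others as earlier twins.
    have hmax := F.max'_mem hne
    have hlt := (Finset.mem_filter.1 (Finset.mem_sdiff.1 (Finset.mem_filter.1 hmax).1).1).2
    have : (F.erase (F.max' hne)).card < 2 * d := by
      refine lt_of_le_of_lt (Finset.card_le_card fun u hu => ?_) hlt
      obtain ⟨hu1, hu2⟩ := Finset.mem_erase.1 hu
      exact Finset.mem_filter.2 ⟨Finset.mem_univ _, lt_of_le_of_ne (F.le_max' u hu2) hu1,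
        htwin u hu2 _ hmax⟩
    rw [Finset.card_erase_of_mem hmax] at this
    omega
  · refine (Finset.card_le_card (t := X.powerset ×ˢ X.powerset) fun c hc => ?_).trans ?_
    · obtain ⟨v, -, rfl⟩ := Finset.mem_image.1 hc
      simp [Finset.filter_subset]
    · simp

/-- If the core is large then there are `d` disjoint arcs. -/
theorem exists_packing_of_card_core {Q : List (Fin n) → Prop} (hQ : IsPathKind r Q)
    (hr : ∀ v, ¬ r v v) (d : ℕ) (h : 2 ^ (7 * d) < (core r d).card) :
    ∃ Ps, IsPacking Q Ps ∧ d ≤ edgeCount Ps := by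
  rcases exists_packing_or_cover hQ hr d with ⟨Ps, h1, h2, -⟩ | ⟨X, hX, hc⟩
  · exact ⟨Ps, h1, h2.ge⟩
  exfalso
  rcases Nat.eq_zero_or_pos d with rfl | hd
  · simp [core] at h
  have h1 := card_core_le d X hc
  have h2 : 2 ^ X.card ≤ 2 ^ (2 * d) := Nat.pow_le_pow_right (by omega) hX
  have h3 : 2 ^ X.card * 2 ^ X.card ≤ 2 ^ (2 * d) * 2 ^ (2 * d) := Nat.mul_le_mul h2 h2
  have h4 : d < 2 ^ d := Nat.lt_two_pow_self
  have h5 : 2 ^ (7 * d) = 2 ^ d * 2 ^ d * 2 ^ d * (2 ^ (2 * d) * 2 ^ (2 * d)) := by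
    rw [← pow_add, ← pow_add, ← pow_add, ← pow_add]
    congr 1
    ring
  have h6 : 2 ≤ 2 ^ d := by
    calc 2 = 2 ^ 1 := rfl
      _ ≤ 2 ^ d := Nat.pow_le_pow_right (by omega) hd
  have h7 : 1 ≤ 2 ^ (2 * d) * 2 ^ (2 * d) := Nat.mul_pos (by positivity) (by positivity)
  have h8 : (core r d).card ≤ 2 * d + 2 * d * (2 ^ (2 * d) * 2 ^ (2 * d)) :=
    h1.trans (add_le_add hX (Nat.mul_le_mul_left _ h3))
  rw [h5] at h
  generalize 2 ^ (2 * d) * 2 ^ (2 * d) = A at *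
  generalize 2 ^ d = B at *
  have h9 : 4 * d ≤ B * B * B := by nlinarith [Nat.mul_le_mul h6 h6]
  have := Nat.mul_le_mul_right A h9
  nlinarith

/-- A small packing can be moved into the core. -/
theorem IsPacking.exists_in_core {Q : List (Fin n) → Prop} (hQ : IsPathKind r Q) {d : ℕ}
    {Ps : List (List (Fin n))} (h : IsPacking Q Ps) (hd : Ps.flatten.length ≤ 2 * d) :
    ∃ σ : Equiv.Perm (Fin n), IsPacking Q (Ps.map (List.map σ)) ∧
      ∀ v ∈ Ps.flatten, σ v ∈ core r d := by
  classical
  obtain ⟨σ, h1, h2, -⟩ := exists_automorphism (r := r) d Ps.flatten.toFinset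
    ((List.toFinset_card_le _).trans hd)
  refine ⟨σ, ⟨fun P hP => ?_, ?_⟩, fun v hv => h2 v (List.mem_toFinset.2 hv)⟩
  · obtain ⟨P', hP', rfl⟩ := List.mem_map.1 hP
    exact hQ.map σ h1 (h.1 P' hP')
  · rw [← List.map_flatten]
    exact h.2.map σ.injective

/-- A path in the core that is not a shortest path has a competitor in the core. -/
theorem exists_shorter_in_core {d : ℕ} {p : List (Fin n)} (hp : IsPath r p)
    (hd : p.length ≤ d + 1) (hc : ∀ v ∈ p, v ∈ core r d) (h : ¬ IsShortestPath r p) :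
    ∃ q, IsPath r q ∧ q.head? = p.head? ∧ q.getLast? = p.getLast? ∧ q.length < p.length ∧
      ∀ v ∈ q, v ∈ core r d := by
  classical
  simp only [IsShortestPath, hp, true_and, not_forall, not_le] at h
  obtain ⟨q, hq, hh, hl, hlt⟩ := h
  obtain ⟨σ, h1, h2, h3⟩ := exists_automorphism (r := r) d q.toFinset
    ((List.toFinset_card_le _).trans (by omega))
  refine ⟨q.map σ, hq.map σ h1, ?_, ?_, by simpa using hlt, fun v hv => ?_⟩
  · rw [List.head?_map, List.head?_eq_some_head hq.1, ← hh, List.head?_eq_some_head hq.1,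
      Option.map_some, h3 _ (by simp)]
    exact hc _ (List.mem_of_mem_head? (by rw [← hh, List.head?_eq_some_head hq.1]; rfl))
  · rw [List.getLast?_map, List.getLast?_eq_some_getLast hq.1, ← hl,
      List.getLast?_eq_some_getLast hq.1, Option.map_some, h3 _ (by simp)]
    exact hc _ (List.mem_of_mem_getLast? (by rw [← hl, List.getLast?_eq_some_getLast hq.1]; rfl))
  · obtain ⟨w, hw, rfl⟩ := List.mem_map.1 hv
    exact h2 w (by simpa using hw)

end Twins

/-! ### Logical connectives as terms -/

/-- A term, read as a proposition about its variables. -/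
def Tm.Holds (e : Tm) (I : Input) (ρ : ℕ → ℕ) : Prop := e.eval I ρ ≠ 0

namespace Tm

/-- Negation, with value `0` or `1`. -/
def not (a : Tm) : Tm := .sub (.const 1) a
def and (a b : Tm) : Tm := .mul a b
def or (a b : Tm) : Tm := .add a b
def le (a b : Tm) : Tm := not (.sub a b)
def lt (a b : Tm) : Tm := .sub b a
def eq (a b : Tm) : Tm := not (.add (.sub a b) (.sub b a))
/-- Bounded existential quantification. -/
def ex (a b : Tm) : Tm := .sum a b
/-- Bounded universal quantification. -/
def all (a b : Tm) : Tm := not (.sum a (not b))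
/-- The number of values of variable `0` below `a` for which `b` holds. -/
def count (a b : Tm) : Tm := .sum a (not (not b))

variable (I : Input) (ρ : ℕ → ℕ) (a b c : Tm)

@[simp] theorem holds_not : a.not.Holds I ρ ↔ ¬ a.Holds I ρ := by
  simp only [Holds, not, eval]; omega

@[simp] theorem holds_and : (a.and b).Holds I ρ ↔ a.Holds I ρ ∧ b.Holds I ρ := by
  simp [Holds, and, eval]

@[simp] theorem holds_or : (a.or b).Holds I ρ ↔ a.Holds I ρ ∨ b.Holds I ρ := by
  simp only [Holds, or, eval]; omega

@[simp] theorem holds_le : (a.le b).Holds I ρ ↔ a.eval I ρ ≤ b.eval I ρ := by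
  simp only [Holds, le, not, eval]; omega

@[simp] theorem holds_lt : (a.lt b).Holds I ρ ↔ a.eval I ρ < b.eval I ρ := by
  simp only [Holds, lt, eval]; omega

@[simp] theorem holds_eq : (a.eq b).Holds I ρ ↔ a.eval I ρ = b.eval I ρ := by
  simp only [Holds, eq, not, eval]; omega

@[simp] theorem holds_ex :
    (a.ex b).Holds I ρ ↔ ∃ i < a.eval I ρ, b.Holds I (extend i ρ) := by
  simp [Holds, ex, eval]

@[simp] theorem holds_all :
    (a.all b).Holds I ρ ↔ ∀ i < a.eval I ρ, b.Holds I (extend i ρ) := by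
  rw [all, holds_not, Holds, eval]
  have h : ∀ i, b.not.eval I (extend i ρ) = 0 ↔ b.Holds I (extend i ρ) := fun i => by
    have := holds_not I (extend i ρ) b
    simp only [Holds] at this ⊢
    omega
  simp [h]

open Classical in
@[simp] theorem eval_count : (count a b).eval I ρ =
    ((Finset.range (a.eval I ρ)).filter fun i => b.Holds I (extend i ρ)).card := by
  rw [count, eval, Finset.card_filter]
  refine Finset.sum_congr rfl fun i _ => ?_
  by_cases h : b.eval I (extend i ρ) = 0
  · simp [not, eval, Holds, h]
  · simp only [not, eval, Holds, ne_eq, h, not_false_eq_true, if_true]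
    omega

@[simp] theorem holds_call (f : Tm) : (call f a b c).Holds I ρ ↔
    f.Holds I (args (a.eval I ρ) (b.eval I ρ) (c.eval I ρ)) := Iff.rfl

end Tm

/-! ### The decision procedure as a term -/

namespace Tm

/-- `2 ^ (7 * d)`: if the core is larger than this then there are `d` disjoint arcs. -/
def base : Tm := .pow2 (.mul (.const 7) .par)

/-- The quotient of variables `0` and `1`. -/
def quot : Tm := count (.var 0) (le (.mul (.add (.var 0) (.const 1)) (.var 2)) (.var 1))

/-- Digit number `var 1` of `var 0`, to the base `base`. -/
def digit : Tm :=
  .sub (.call quot (.var 0) (.pow2 (.mul (.mul (.const 7) .par) (.var 1))) (.const 0))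
    (.mul (.call quot (.call quot (.var 0) (.pow2 (.mul (.mul (.const 7) .par) (.var 1)))
      (.const 0)) base (.const 0)) base)

/-- The entry of the adjacency matrix in row `u` and column `v`. -/
def adj (u v : Tm) : Tm := .entry (.add (.mul u .order) v)

/-- The vertices `var 0` and `var 1` are twins. -/
def twin : Tm := all .order (and (eq (adj (.var 1) (.var 0)) (adj (.var 2) (.var 0)))
  (eq (adj (.var 0) (.var 1)) (adj (.var 0) (.var 2))))

/-- `var 0` is a vertex of the core. -/
def inCore : Tm := and (lt (.var 0) .order)
  (lt (count (.var 0) (.call twin (.var 0) (.var 1) (.const 0))) (.mul (.const 2) .par))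

/-- The number of vertices of the core before `var 0`. -/
def rank : Tm := count (.var 0) (.call inCore (.var 0) (.const 0) (.const 0))

/-- The vertex of the core with rank `var 0`. -/
def unrank : Tm := .sum .order (.mul (.var 0) (not (not (and
  (.call inCore (.var 0) (.const 0) (.const 0))
  (eq (.call rank (.var 0) (.const 0) (.const 0)) (.var 1))))))

/-- A number `var 0` is read as a table of vertices with rows of length `d + 1`; this is the
vertex in row `var 1` at position `var 2`. -/
def vert : Tm := .call unrank (.call digit (.var 0)
  (.add (.mul (.var 1) (.add .par (.const 1))) (.var 2)) (.const 0)) (.const 0) (.const 0)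

/-- The first `var 2` entries of row `var 1` of the table `var 0` form a path in the core. -/
def path : Tm :=
  and (.var 2)
  (and (all (.var 2) (.call inCore (.call vert (.var 1) (.var 2) (.var 0)) (.const 0) (.const 0)))
  (and (all (.var 2) (all (.var 3) (or (eq (.var 0) (.var 1)) (not
    (eq (.call vert (.var 2) (.var 3) (.var 1)) (.call vert (.var 2) (.var 3) (.var 0)))))))
  (all (.sub (.var 2) (.const 1)) (adj (.call vert (.var 1) (.var 2) (.var 0))
    (.call vert (.var 1) (.var 2) (.add (.var 0) (.const 1)))))))

/-- The path given as in `path` is induced. -/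
def induced : Tm := all (.var 2) (all (.var 3) (or
  (not (adj (.call vert (.var 2) (.var 3) (.var 1)) (.call vert (.var 2) (.var 3) (.var 0))))
  (or (eq (.var 0) (.add (.var 1) (.const 1))) (eq (.var 1) (.add (.var 0) (.const 1))))))

/-- Strict upper bound for the tables to be considered: `base ^ (d * (d + 1))`, enough for `d` rows
of length `d + 1`. -/
def tables : Tm :=
  .pow2 (.mul (.mul (.const 7) .par) (.mul .par (.add .par (.const 1))))

/-- The path given as in `path` is a shortest path: no row `0` of a table is a shorter path with
the same ends. -/
def shortest : Tm := not (ex tables (ex (.var 3) (and (.call path (.var 1) (.const 0) (.var 0))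
  (and (eq (.call vert (.var 1) (.const 0) (.const 0)) (.call vert (.var 2) (.var 3) (.const 0)))
    (eq (.call vert (.var 1) (.const 0) (.sub (.var 0) (.const 1)))
      (.call vert (.var 2) (.var 3) (.sub (.var 4) (.const 1))))))))

/-- The rows of the table `var 0`, cut off after the lengths given by the digits of `var 1`, form
a packing of paths that satisfy `chk`, with at least `d` edges. Rows of length `0` do not count. -/
def packing (chk : Tm) : Tm :=
  and (le .par (.sum .par (.sub (.call digit (.var 2) (.var 0) (.const 0)) (.const 1))))
  (and (all .par (or (not (.call digit (.var 2) (.var 0) (.const 0)))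
    (and (le (.call digit (.var 2) (.var 0) (.const 0)) (.add .par (.const 1)))
    (and (.call path (.var 1) (.var 0) (.call digit (.var 2) (.var 0) (.const 0)))
      (.call chk (.var 1) (.var 0) (.call digit (.var 2) (.var 0) (.const 0)))))))
  (all .par (all .par (or (eq (.var 0) (.var 1))
    (all (.call digit (.var 3) (.var 1) (.const 0)) (all (.call digit (.var 4) (.var 1) (.const 0))
      (not (eq (.call vert (.var 4) (.var 3) (.var 1))
        (.call vert (.var 4) (.var 2) (.var 0))))))))))

/-- The decision procedure: a large core, or a packing found by exhaustive search. -/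
def solve (chk : Tm) : Tm := or (lt base (.call rank .order (.const 0) (.const 0)))
  (ex tables (ex tables (.call (packing chk) (.var 1) (.var 0) (.const 0))))

theorem ok_solve_path : (solve (.const 1)).ok (fun _ => false) = true := by decide +kernel

theorem ok_solve_induced : (solve induced).ok (fun _ => false) = true := by decide +kernel

theorem ok_solve_shortest : (solve shortest).ok (fun _ => false) = true := by decide +kernel

end Tm

/-! ### Correctness of the procedure -/

section Semantics

variable {n k : ℕ} {r : Fin n → Fin n → Prop}

/-- Every sequence of digits is that of a number. -/
theorem exists_digits (B : ℕ) (m : ℕ) (φ : ℕ → ℕ) (hφ : ∀ i, φ i < B) :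
    ∃ c < B ^ m, ∀ i < m, c / B ^ i % B = φ i := by
  induction m generalizing φ with
  | zero => exact ⟨0, by simp, by simp⟩
  | succ m ih =>
    obtain ⟨c, hc, h⟩ := ih (fun i => φ (i + 1)) fun i => hφ _
    have hB : 0 < B := (Nat.zero_le _).trans_lt (hφ 0)
    refine ⟨φ 0 + B * c, ?_, fun i hi => ?_⟩
    · have := hφ 0
      rw [pow_succ']
      nlinarith
    · cases i with
      | zero => simp [Nat.mod_eq_of_lt (hφ 0)]
      | succ i =>
        rw [pow_succ', ← Nat.div_div_eq_div_mul, Nat.add_mul_div_left _ _ hB,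
          Nat.div_eq_of_lt (hφ 0), zero_add]
        exact h i (by omega)

theorem Tm.eval_quot (I : Input) (x y z : ℕ) (hy : 0 < y) :
    Tm.quot.eval I (args x y z) = x / y := by
  simp only [Tm.quot, Tm.eval_count, Tm.holds_le, Tm.eval, extend, args]
  have : (Finset.range x).filter (fun i => (i + 1) * y ≤ x) = Finset.range (x / y) := by
    ext i
    simp only [Finset.mem_filter, Finset.mem_range, ← Nat.le_div_iff_mul_le hy]
    have := Nat.div_le_self x y
    omega
  rw [this, Finset.card_range]

theorem Tm.eval_digit (I : Input) (c j z : ℕ) :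
    Tm.digit.eval I (args c j z) = c / (2 ^ (7 * I.par)) ^ j % 2 ^ (7 * I.par) := by
  simp only [Tm.digit, Tm.base, Tm.eval, args]
  rw [Tm.eval_quot _ _ _ _ (by positivity), Tm.eval_quot _ _ _ _ (by positivity), pow_mul _ _ j,
    Nat.mod_eq_sub_div_mul]

theorem adj_inputOf (u v : Fin n) : (inputOf n k r).entry (u * n + v) ≠ 0 ↔ r u v := by
  rcases entry_inputOf n k r u v with h | h <;> simp [h]

theorem entry_eq_iff (u v u' v' : Fin n) :
    (inputOf n k r).entry (u * n + v) = (inputOf n k r).entry (u' * n + v') ↔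
      (r u v ↔ r u' v') := by
  rcases entry_inputOf n k r u v with h | h <;> rcases entry_inputOf n k r u' v' with h' | h' <;>
    simp [h, h']

theorem holds_adj (a b : Tm) (ρ : ℕ → ℕ) (u v : Fin n) (ha : a.eval (inputOf n k r) ρ = u)
    (hb : b.eval (inputOf n k r) ρ = v) : (Tm.adj a b).Holds (inputOf n k r) ρ ↔ r u v := by
  refine Iff.trans ?_ (adj_inputOf (k := k) u v)
  simp only [Tm.adj, Tm.Holds, Tm.eval, ha, hb]
  rfl

theorem holds_twin (u v : Fin n) (z : ℕ) :
    Tm.twin.Holds (inputOf n k r) (args u v z) ↔ Twin r u v := by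
  simp only [Tm.twin, Tm.holds_all, Tm.holds_and, Tm.holds_eq, Tm.adj, Tm.eval, extend, args]
  refine ⟨fun h w => ?_, fun h w hw => ?_⟩
  · have := h w w.2
    exact ⟨(entry_eq_iff _ _ _ _).1 this.1, (entry_eq_iff _ _ _ _).1 this.2⟩
  · exact ⟨(entry_eq_iff _ ⟨w, hw⟩ _ ⟨w, hw⟩).2 (h ⟨w, hw⟩).1,
      (entry_eq_iff ⟨w, hw⟩ _ ⟨w, hw⟩ _).2 (h ⟨w, hw⟩).2⟩

theorem card_filter_range (v : ℕ) (hv : v ≤ n) (p : ℕ → Prop) [DecidablePred p]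
    (q : Fin n → Prop) [DecidablePred q] (h : ∀ u : Fin n, p u ↔ q u) :
    ((Finset.range v).filter p).card =
      (Finset.univ.filter fun u : Fin n => u.val < v ∧ q u).card := by
  rw [← Finset.card_map Fin.valEmbedding]
  congr 1
  ext i
  simp only [Finset.mem_filter, Finset.mem_range, Finset.mem_map, Finset.mem_univ, true_and,
    Fin.valEmbedding_apply]
  constructor
  · rintro ⟨hi, hp⟩
    exact ⟨⟨i, hi.trans_le hv⟩, ⟨hi, (h ⟨i, hi.trans_le hv⟩).1 hp⟩, rfl⟩
  · rintro ⟨u, ⟨hi, hq⟩, rfl⟩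
    exact ⟨hi, (h u).2 hq⟩

theorem holds_inCore (v : Fin n) (y z : ℕ) :
    Tm.inCore.Holds (inputOf n k r) (args v y z) ↔ v ∈ core r (n - k) := by
  classical
  have : (inputOf n k r).order = n := rfl
  simp only [Tm.inCore, Tm.holds_and, Tm.holds_lt, Tm.eval, Tm.eval_count, Tm.holds_call, args,
    extend, this, v.2, true_and, core, Finset.mem_filter, Finset.mem_univ]
  rw [card_filter_range v v.2.le _ (fun u => Twin r u v) fun u => holds_twin u v 0]
  rfl

theorem lt_of_holds_inCore {v y z : ℕ} (h : Tm.inCore.Holds (inputOf n k r) (args v y z)) :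
    v < n := by
  simp only [Tm.inCore, Tm.holds_and, Tm.holds_lt, Tm.eval, args] at h
  exact h.1

open Classical in
theorem eval_rank (v : ℕ) (hv : v ≤ n) (y z : ℕ) : Tm.rank.eval (inputOf n k r) (args v y z) =
    ((core r (n - k)).filter fun u => u.val < v).card := by
  simp only [Tm.rank, Tm.eval, Tm.eval_count, Tm.holds_call, args, extend]
  rw [card_filter_range v hv _ (fun u => u ∈ core r (n - k)) fun u => holds_inCore u 0 0]
  congr 1
  ext u
  simp [and_comm]

open Classical in
theorem eval_unrank {v : Fin n} (hv : v ∈ core r (n - k)) (y z : ℕ) :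
    Tm.unrank.eval (inputOf n k r)
      (args ((core r (n - k)).filter fun u => u.val < v.val).card y z) = v := by
  have ho : (inputOf n k r).order = n := rfl
  simp only [Tm.unrank, Tm.eval, ho]
  have hterm : ∀ (e : Tm) (ρ : ℕ → ℕ), e.not.not.eval (inputOf n k r) ρ =
      if e.Holds (inputOf n k r) ρ then 1 else 0 := fun e ρ => by
    by_cases h : e.eval (inputOf n k r) ρ = 0
    · simp [Tm.not, Tm.eval, Tm.Holds, h]
    · simp only [Tm.not, Tm.eval, Tm.Holds, ne_eq, h, not_false_eq_true, if_true]
      omega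
  rw [Finset.sum_eq_single v.val]
  · rw [hterm, if_pos]
    · simp [extend]
    · simp only [Tm.holds_and, Tm.holds_call, Tm.holds_eq, Tm.eval, extend, args]
      exact ⟨(holds_inCore v 0 0).2 hv, eval_rank v v.2.le 0 0⟩
  · intro i hi hne
    rw [Finset.mem_range] at hi
    rw [hterm, if_neg, mul_zero]
    simp only [Tm.holds_and, Tm.holds_call, Tm.holds_eq, Tm.eval, extend, args, not_and]
    intro hc
    rw [holds_inCore (⟨i, hi⟩ : Fin n) 0 0] at hc
    rw [eval_rank i hi.le 0 0]
    -- Vertices of the core have different ranks.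
    have key : ∀ a b : Fin n, a < b → a ∈ core r (n - k) →
        ((core r (n - k)).filter fun u => u.val < a.val).card <
          ((core r (n - k)).filter fun u => u.val < b.val).card := by
      intro a b hab ha
      refine Finset.card_lt_card (Finset.ssubset_iff_of_subset (fun u hu => ?_) |>.2 ⟨a, ?_, ?_⟩)
      · rw [Finset.mem_filter] at hu ⊢
        exact ⟨hu.1, hu.2.trans hab⟩
      · exact Finset.mem_filter.2 ⟨ha, hab⟩
      · simp
    rcases lt_or_gt_of_ne hne with h | h
    · exact (key ⟨i, hi⟩ v h hc).ne
    · exact (key v ⟨i, hi⟩ h hv).ne'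
  · simp

/-- The path `p` is an initial segment of row `b` of the table `c`. -/
def InRow (n k : ℕ) (r : Fin n → Fin n → Prop) (c b : ℕ) (p : List (Fin n)) : Prop :=
  ∀ (j : ℕ) (h : j < p.length), Tm.vert.eval (inputOf n k r) (args c b j) = p[j]

theorem holds_path {c b : ℕ} {p : List (Fin n)} (h : InRow n k r c b p) :
    Tm.path.Holds (inputOf n k r) (args c b p.length) ↔
      IsPath r p ∧ ∀ v ∈ p, v ∈ core r (n - k) := by
  have hnil : (Tm.var 2).Holds (inputOf n k r) (args c b p.length) ↔ p ≠ [] := by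
    simp [Tm.Holds, Tm.eval, args]
  have hcore : (∀ i < p.length, Tm.inCore.Holds (inputOf n k r)
      (args (Tm.vert.eval (inputOf n k r) (args c b i)) 0 0)) ↔ ∀ v ∈ p, v ∈ core r (n - k) := by
    rw [List.forall_mem_iff_getElem]
    refine forall₂_congr fun i hi => ?_
    rw [h i hi, holds_inCore]
  have hnodup : (∀ i < p.length, ∀ j < p.length, j = i ∨
      ¬ Tm.vert.eval (inputOf n k r) (args c b i) = Tm.vert.eval (inputOf n k r) (args c b j)) ↔
      p.Nodup := by
    rw [List.nodup_iff_injective_getElem]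
    refine ⟨fun hp i j hij => ?_, fun hp i hi j hj => ?_⟩
    · have := (hp i i.2 j j.2).resolve_right (by
        rw [h i i.2, h j j.2]
        simpa using congrArg Fin.val hij)
      exact (Fin.ext this).symm
    · rw [h i hi, h j hj, or_iff_not_imp_right, not_not]
      intro e
      have := @hp ⟨i, hi⟩ ⟨j, hj⟩ (Fin.ext e)
      simpa using this.symm
  have hchain : (∀ i < p.length - 1, (Tm.adj (.call Tm.vert (.var 1) (.var 2) (.var 0))
      (.call Tm.vert (.var 1) (.var 2) (.add (.var 0) (.const 1)))).Holds (inputOf n k r)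
        (extend i (args c b p.length))) ↔ p.IsChain r := by
    rw [List.isChain_iff_getElem]
    have key : ∀ i (hi : i + 1 < p.length), _ ↔ _ := fun i hi =>
      holds_adj (k := k) (r := r) (.call Tm.vert (.var 1) (.var 2) (.var 0))
        (.call Tm.vert (.var 1) (.var 2) (.add (.var 0) (.const 1)))
        (extend i (args c b p.length)) p[i] p[i + 1] (h i (by omega)) (h (i + 1) hi)
    exact ⟨fun hp i hi => (key i hi).1 (hp i (by omega)),
      fun hp i hi => (key i (by omega)).2 (hp i (by omega))⟩
  simp only [Tm.path, Tm.holds_and, hnil, Tm.holds_all, Tm.holds_call, Tm.holds_or, Tm.holds_not,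
    Tm.holds_eq, Tm.eval]
  simp only [extend, args] at hcore hnodup hchain ⊢
  rw [hcore, hnodup, hchain, IsPath]
  tauto

theorem exists_inRow {c b l : ℕ} (h : Tm.path.Holds (inputOf n k r) (args c b l)) :
    ∃ p : List (Fin n), p.length = l ∧ InRow n k r c b p := by
  simp only [Tm.path, Tm.holds_and, Tm.holds_all, Tm.holds_call, Tm.eval, extend, args] at h
  refine ⟨List.ofFn fun j : Fin l => ⟨_, lt_of_holds_inCore (h.2.1 j j.2)⟩, by simp, ?_⟩
  intro j hj
  simp

/-- The term `chk` decides whether a path in the core, given by a row of a table, is of the kind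
`Q`. -/
def Checks (n k : ℕ) (r : Fin n → Fin n → Prop) (chk : Tm) (Q : List (Fin n) → Prop) : Prop :=
  ∀ c b p, InRow n k r c b p → IsPath r p → (∀ v ∈ p, v ∈ core r (n - k)) →
    p.length ≤ n - k + 1 → (chk.Holds (inputOf n k r) (args c b p.length) ↔ Q p)

theorem checks_isPath : Checks n k r (.const 1) (IsPath r) := fun c b p _ hp _ _ => by
  simp [Tm.Holds, Tm.eval, hp]

theorem checks_isInducedPath : Checks n k r Tm.induced (IsInducedPath r) := fun c b p h hp _ _ => by
  simp only [Tm.induced, IsInducedPath, hp, true_and, Tm.holds_all, Tm.holds_or, Tm.holds_not,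
    Tm.holds_eq, Tm.eval]
  have key : ∀ i j (hi : i < p.length) (hj : j < p.length), _ ↔ _ := fun i j hi hj =>
    holds_adj (k := k) (r := r) (.call Tm.vert (.var 2) (.var 3) (.var 1))
      (.call Tm.vert (.var 2) (.var 3) (.var 0))
      (extend j (extend i (args c b p.length))) p[i] p[j] (h i hi) (h j hj)
  constructor
  · intro hp i j hij
    have := hp i i.2 j j.2
    rw [key i j i.2 j.2] at this
    exact this.resolve_left (not_not.2 hij)
  · intro hp i hi j hj
    simp only [extend, args] at hi hj
    rw [key i j hi hj]
    by_cases hij : r p[i] p[j]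
    · exact Or.inr (hp ⟨i, hi⟩ ⟨j, hj⟩ hij)
    · exact Or.inl hij

/-- Any `n - k` short paths in the core are the rows of some table. -/
theorem exists_table (hcard : (core r (n - k)).card ≤ 2 ^ (7 * (n - k))) (P : ℕ → List (Fin n))
    (hlen : ∀ b < n - k, (P b).length ≤ n - k + 1) (hP : ∀ b < n - k, ∀ v ∈ P b, v ∈ core r (n - k))
    (ρ : ℕ → ℕ) :
    ∃ c < Tm.tables.eval (inputOf n k r) ρ, ∀ b < n - k, InRow n k r c b (P b) := by
  classical
  set d := n - k with hd
  have hpar : (inputOf n k r).par = d := rfl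
  obtain ⟨c, hc, h⟩ := exists_digits (2 ^ (7 * d)) (d * (d + 1)) (fun i =>
    if hi : i / (d + 1) < d ∧ i % (d + 1) < (P (i / (d + 1))).length then
      ((core r d).filter fun u => u.val < ((P (i / (d + 1)))[i % (d + 1)]'hi.2).val).card
    else 0) (fun i => by
      split_ifs with hi
      · refine lt_of_lt_of_le (Finset.card_lt_card (Finset.ssubset_iff_of_subset
          (Finset.filter_subset _ _) |>.2 ⟨_, hP _ hi.1 _ (List.getElem_mem hi.2), ?_⟩)) hcard
        simp
      · positivity)
  refine ⟨c, ?_, fun b hb j hj => ?_⟩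
  · simp only [Tm.tables, Tm.eval, hpar]
    rwa [pow_mul]
  · have hj' : j < d + 1 := hj.trans_le (hlen b hb)
    have h1 : (b * (d + 1) + j) / (d + 1) = b := by
      rw [mul_comm, Nat.mul_add_div (by omega), Nat.div_eq_of_lt hj', add_zero]
    have h2 : (b * (d + 1) + j) % (d + 1) = j := by
      rw [mul_comm, Nat.mul_add_mod, Nat.mod_eq_of_lt hj']
    have h3 := h (b * (d + 1) + j) (by nlinarith)
    simp only [h1, h2, hb, hj, true_and, dite_true] at h3
    simp only [Tm.vert, Tm.eval, args, Tm.eval_digit, hpar, h3]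
    exact eval_unrank (hP b hb _ (List.getElem_mem hj)) 0 0

theorem checks_isShortestPath (hcard : (core r (n - k)).card ≤ 2 ^ (7 * (n - k))) :
    Checks n k r Tm.shortest (IsShortestPath r) := fun c b p h hp hc hlen => by
  have hpos : 0 < p.length := List.length_pos_iff.2 hp.1
  -- The comparison of the table entries in `Tm.shortest` says that the ends agree.
  have hends : ∀ (c' : ℕ) (q : List (Fin n)), q ≠ [] → InRow n k r c' 0 q →
      (q.head? = p.head? ∧ q.getLast? = p.getLast? ↔
        Tm.vert.eval (inputOf n k r) (args c' 0 0) = Tm.vert.eval (inputOf n k r) (args c b 0) ∧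
        Tm.vert.eval (inputOf n k r) (args c' 0 (q.length - 1)) =
          Tm.vert.eval (inputOf n k r) (args c b (p.length - 1))) := by
    intro c' q hq hrow
    have hqpos : 0 < q.length := List.length_pos_iff.2 hq
    rw [hrow 0 hqpos, h 0 hpos, hrow _ (by omega : q.length - 1 < q.length),
      h _ (by omega : p.length - 1 < p.length), List.head?_eq_getElem?, List.head?_eq_getElem?,
      List.getLast?_eq_getElem?, List.getLast?_eq_getElem?, List.getElem?_eq_getElem hqpos,
      List.getElem?_eq_getElem hpos,
      List.getElem?_eq_getElem (by omega : q.length - 1 < q.length),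
      List.getElem?_eq_getElem (by omega : p.length - 1 < p.length)]
    simp only [Option.some.injEq, Fin.ext_iff]
  rw [← not_iff_not]
  simp only [Tm.shortest, Tm.holds_not, not_not, Tm.holds_ex, Tm.holds_and, Tm.holds_call,
    Tm.holds_eq, Tm.eval]
  simp only [extend, args]
  constructor
  · rintro ⟨c', -, l, hl, hpath, he⟩ hs
    obtain ⟨q, rfl, hrow⟩ := exists_inRow hpath
    have hq := (holds_path hrow).1 hpath
    have he' := (hends c' q hq.1.1 hrow).2 he
    exact absurd (hs.2 q hq.1 he'.1 he'.2) (by omega)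
  · intro hs
    obtain ⟨q, hq, hh, hl, hlt, hqc⟩ := exists_shorter_in_core hp hlen hc hs
    obtain ⟨c', hc', hrow⟩ := exists_table hcard (fun _ => q) (fun _ _ => by omega)
      (fun _ _ => hqc) (args c b p.length)
    have hqpos : 0 < q.length := List.length_pos_iff.2 hq.1
    have hrow := hrow 0 (by omega)
    exact ⟨c', hc', q.length, hlt, (holds_path hrow).2 ⟨hq, hqc⟩,
      (hends c' q hq.1 hrow).1 ⟨hh, hl⟩⟩

end Semantics

/-! ### Fixed-parameter tractability -/

section Tractability

variable {n k : ℕ} {r : Fin n → Fin n → Prop} {Q : List (Fin n) → Prop}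

theorem edgeCount_map_range {V : Type} (p : ℕ → List V) (d : ℕ) :
    edgeCount ((List.range d).map p) = ∑ b ∈ Finset.range d, ((p b).length - 1) := by
  induction d with
  | zero => rfl
  | succ d ih => simp_all [edgeCount, List.range_succ, Finset.sum_range_succ]

theorem edgeCount_filter_ne_nil {V : Type} (Ps : List (List V)) :
    edgeCount (Ps.filter fun p => !p.isEmpty) = edgeCount Ps := by
  induction Ps with
  | nil => rfl
  | cons p Ps ih => cases p <;> simp_all [edgeCount]

/-- Disjoint paths given as a sequence, of which some may be empty, form a packing. -/
theorem IsPacking.of_rows {V : Type} {r : V → V → Prop} {Q : List V → Prop} (hQ : IsPathKind r Q)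
    (p : ℕ → List V) (d : ℕ) (h : ∀ b < d, p b = [] ∨ Q (p b))
    (hdis : ∀ b < d, ∀ b' < d, b ≠ b' → (p b).Disjoint (p b')) :
    ∃ Ps, IsPacking Q Ps ∧ edgeCount Ps = ∑ b ∈ Finset.range d, ((p b).length - 1) := by
  have hQ' : ∀ P ∈ ((List.range d).map p).filter fun p => !p.isEmpty, Q P := by
    intro P hP
    obtain ⟨hP, hne⟩ := List.mem_filter.1 hP
    obtain ⟨b, hb, rfl⟩ := List.mem_map.1 hP
    exact (h b (List.mem_range.1 hb)).resolve_left (by simpa using hne)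
  refine ⟨_, ⟨hQ', List.nodup_flatten.2 ⟨fun P hP => (hQ.isPath (hQ' P hP)).2.1, ?_⟩⟩,
    (edgeCount_filter_ne_nil _).trans (edgeCount_map_range p d)⟩
  refine List.Pairwise.filter _ (List.pairwise_map.2 ?_)
  refine List.Pairwise.imp_of_mem (fun hb hb' hne => ?_) (List.nodup_range (n := d))
  exact hdis _ (List.mem_range.1 hb) _ (List.mem_range.1 hb') hne

theorem getD_nil_eq_or_mem {V : Type} (Ps : List (List V)) (b : ℕ) :
    Ps.getD b [] = [] ∨ Ps.getD b [] ∈ Ps := by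
  by_cases hb : b < Ps.length
  · right
    rw [List.getD_eq_getElem _ _ hb]
    exact List.getElem_mem hb
  · left
    exact List.getD_eq_default _ _ (by omega)

/-- A packing as a sequence of `d` disjoint paths, filled up by empty ones. -/
theorem IsPacking.rows {V : Type} {Q : List V → Prop} {Ps : List (List V)} (h : IsPacking Q Ps)
    (d : ℕ) (hd : Ps.length ≤ d) :
    (∀ b, Ps.getD b [] = [] ∨ Q (Ps.getD b [])) ∧
      (∀ b b', b ≠ b' → (Ps.getD b []).Disjoint (Ps.getD b' [])) ∧
      edgeCount Ps = ∑ b ∈ Finset.range d, ((Ps.getD b []).length - 1) := by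
  refine ⟨fun b => (getD_nil_eq_or_mem Ps b).imp_right (h.1 _), ?_, ?_⟩
  · have hp := List.pairwise_iff_getElem.1 (List.nodup_flatten.1 h.2).2
    intro b b' hne
    by_cases hb : b < Ps.length
    · by_cases hb' : b' < Ps.length
      · rw [List.getD_eq_getElem _ _ hb, List.getD_eq_getElem _ _ hb']
        rcases lt_or_gt_of_ne hne with hlt | hlt
        · exact hp b b' hb hb' hlt
        · exact (hp b' b hb' hb hlt).symm
      · rw [List.getD_eq_default _ _ (by omega : Ps.length ≤ b')]
        simp
    · rw [List.getD_eq_default _ _ (by omega : Ps.length ≤ b)]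
      simp
  · rw [← Finset.sum_subset (Finset.range_subset_range.2 hd), ← edgeCount_map_range]
    · congr 1
      refine List.ext_getElem (by simp) fun i hi _ => ?_
      simp [hi]
    · intro b _ hb
      rw [List.getD_eq_default _ _ (by simpa using hb)]
      rfl

/-- The procedure is correct, provided that `chk` recognizes the kind of paths. This is asked for
only where the core is small, since otherwise the tables do not exhaust the paths in the core. -/
theorem holds_solve (hr : ∀ v, ¬ r v v) (hQ : IsPathKind r Q) (chk : Tm)
    (hchk : (core r (n - k)).card ≤ 2 ^ (7 * (n - k)) → Checks n k r chk Q) (ρ : ℕ → ℕ) :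
    (Tm.solve chk).Holds (inputOf n k r) ρ ↔ HasPartition Q k := by
  classical
  rw [hasPartition_iff_packing hQ, Fintype.card_fin]
  have hpar : (inputOf n k r).par = n - k := rfl
  have hord : (inputOf n k r).order = n := rfl
  have hrank : Tm.rank.eval (inputOf n k r) (args n 0 0) = (core r (n - k)).card := by
    rw [eval_rank n le_rfl]
    simp
  simp only [Tm.solve, Tm.packing, Tm.base, Tm.holds_or, Tm.holds_lt, Tm.holds_ex, Tm.holds_call,
    Tm.holds_and, Tm.holds_le, Tm.holds_all, Tm.holds_not, Tm.holds_eq, Tm.eval, hpar, hord, hrank]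
  rcases lt_or_ge (2 ^ (7 * (n - k))) (core r (n - k)).card with hbig | hsmall
  · exact iff_of_true (Or.inl hbig) (exists_packing_of_card_core hQ hr _ hbig)
  specialize hchk hsmall
  rw [or_iff_right (not_lt.2 hsmall)]
  simp only [extend, args]
  constructor
  · rintro ⟨c, -, c₂, -, hsum, hrow, hdis⟩
    have hp : ∀ b, ∃ p : List (Fin n), b < n - k →
        p.length = Tm.digit.eval (inputOf n k r) (args c₂ b 0) ∧ InRow n k r c b p ∧
          (p = [] ∨ Q p) := by
      intro b
      by_cases hb : b < n - k
      · rcases hrow b hb with h0 | ⟨hle, hpath, hc⟩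
        · exact ⟨[], fun _ => ⟨(not_not.1 h0).symm, fun j hj => absurd hj (by simp), Or.inl rfl⟩⟩
        · obtain ⟨p, hl, hin⟩ := exists_inRow hpath
          rw [← hl] at hpath hle hc
          have hp := (holds_path hin).1 hpath
          exact ⟨p, fun _ => ⟨hl, hin, Or.inr ((hchk c b p hin hp.1 hp.2 hle).1 hc)⟩⟩
      · exact ⟨[], fun h => absurd h hb⟩
    choose p hp using hp
    obtain ⟨Ps, h1, h2⟩ := IsPacking.of_rows hQ p (n - k) (fun b hb => (hp b hb).2.2)
      (fun b hb b' hb' hne => by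
        intro v hv hv'
        obtain ⟨j, hj, rfl⟩ := List.mem_iff_getElem.1 hv
        obtain ⟨j', hj', hvv⟩ := List.mem_iff_getElem.1 hv'
        have h := (hdis b hb b' hb').resolve_left (fun e => hne e.symm) j
          (by rw [← (hp b hb).1]; exact hj) j' (by rw [← (hp b' hb').1]; exact hj')
        rw [(hp b hb).2.1 j hj, (hp b' hb').2.1 j' hj', hvv] at h
        exact h rfl)
    refine ⟨Ps, h1, ?_⟩
    rw [h2]
    refine hsum.trans (Finset.sum_le_sum fun b hb => ?_)
    rw [(hp b (Finset.mem_range.1 hb)).1]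
  · rintro ⟨Ps₀, h₀, hd₀⟩
    obtain ⟨Ps₁, h₁, he₁, hlen₁, -⟩ := h₀.exists_edgeCount_eq hQ _ hd₀
    have hcard₁ := length_le_edgeCount hlen₁
    obtain ⟨σ, h₂, hcore⟩ := h₁.exists_in_core (d := n - k) hQ (by
      rw [length_flatten_eq Ps₁ fun P hP => (hQ.isPath (h₁.1 P hP)).1]
      omega)
    have he₂ : edgeCount (Ps₁.map (List.map σ)) = n - k := by
      rw [← he₁]
      simp [edgeCount, Function.comp_def]
    set Ps := Ps₁.map (List.map σ) with hPs
    have hcard : Ps.length ≤ n - k := by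
      rw [hPs, List.length_map]
      omega
    have hlen : ∀ b, (Ps.getD b []).length ≤ n - k + 1 := fun b => by
      rcases getD_nil_eq_or_mem Ps b with h | h
      · rw [h]
        exact Nat.zero_le _
      · exact he₂ ▸ length_le_edgeCount_succ h
    have hcoreP : ∀ b, ∀ v ∈ Ps.getD b [], v ∈ core r (n - k) := fun b v hv => by
      rcases getD_nil_eq_or_mem Ps b with h | h
      · rw [h] at hv
        exact absurd hv List.not_mem_nil
      · obtain ⟨P', hP', e⟩ := List.mem_map.1 h
        rw [← e] at hv
        obtain ⟨w, hw, rfl⟩ := List.mem_map.1 hv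
        exact hcore w (List.mem_flatten.2 ⟨P', hP', hw⟩)
    obtain ⟨hrows, hdis, hsum⟩ := h₂.rows (n - k) hcard
    obtain ⟨c, hc, hrow⟩ := exists_table hsmall (fun b => Ps.getD b []) (fun b _ => hlen b)
      (fun b _ => hcoreP b) ρ
    obtain ⟨c₂, hc₂, hdigit⟩ : ∃ c₂ < Tm.tables.eval (inputOf n k r) ρ, ∀ b < n - k,
        Tm.digit.eval (inputOf n k r) (args c₂ b 0) = (Ps.getD b []).length := by
      obtain ⟨c₂, hc₂, h⟩ := exists_digits (2 ^ (7 * (n - k))) ((n - k) * (n - k + 1))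
        (fun b => if 0 < n - k then (Ps.getD b []).length else 0) (fun b => by
          -- The lengths are at most `n - k + 1`, which is a digit unless `n - k = 0`.
          split_ifs with h
          · have h1 := hlen b
            have h2 : 7 * (n - k) < 2 ^ (7 * (n - k)) := Nat.lt_two_pow_self
            omega
          · positivity)
      refine ⟨c₂, ?_, fun b hb => ?_⟩
      · simp only [Tm.tables, Tm.eval, hpar]
        rwa [pow_mul]
      · rw [Tm.eval_digit, hpar, h b (by nlinarith), if_pos (by omega)]
    refine ⟨c, hc, c₂, hc₂, ?_, fun b hb => ?_, fun b hb b' hb' => ?_⟩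
    · refine (he₂.symm.trans hsum).trans_le ?_
      refine Finset.sum_le_sum fun b hb => ?_
      rw [hdigit b (Finset.mem_range.1 hb)]
    · rw [Tm.Holds, hdigit b hb]
      rcases hrows b with h | h
      · left
        simp only [h, List.length_nil, ne_eq, not_true_eq_false, not_false_eq_true]
      · right
        have hpath := hQ.isPath h
        exact ⟨hlen b, (holds_path (hrow b hb)).2 ⟨hpath, hcoreP b⟩,
          (hchk c b _ (hrow b hb) hpath (hcoreP b) (hlen b)).2 h⟩
    · by_cases hbb : b' = b
      · exact Or.inl hbb
      · right
        intro j hj j' hj'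
        rw [hdigit b hb] at hj
        rw [hdigit b' hb'] at hj'
        rw [hrow b hb j hj, hrow b' hb' j' hj']
        intro e
        exact hdis b b' (Ne.symm hbb) (List.getElem_mem hj)
          (by rw [Fin.ext e]; exact List.getElem_mem hj')

theorem undirectedDual_isFPT (Q : {V : Type} → (V → V → Prop) → List V → Prop) (chk : Tm)
    (hok : (Tm.solve chk).ok (fun _ => false) = true)
    (hQ : ∀ {V : Type} (r : V → V → Prop), (∀ v, ¬ r v v) → IsPathKind r (Q r))
    (hchk : ∀ (n k : ℕ) (r : Fin n → Fin n → Prop),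
      (core r (n - k)).card ≤ 2 ^ (7 * (n - k)) → Checks n k r chk (Q r)) :
    (undirectedDual Q).IsFPT :=
  isFPT_of_term (undirectedDual Q) UInst.n UInst.k (fun x => x.G.Adj) (fun _ => rfl)
    (fun _ => rfl) (.solve chk) hok
    fun x => holds_solve (fun _ => x.G.irrefl) (hQ _ fun _ => x.G.irrefl) chk (hchk _ _ _) _

theorem directedDual_isFPT (Q : {V : Type} → (V → V → Prop) → List V → Prop) (chk : Tm)
    (hok : (Tm.solve chk).ok (fun _ => false) = true)
    (hQ : ∀ {V : Type} (r : V → V → Prop), (∀ v, ¬ r v v) → IsPathKind r (Q r))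
    (hchk : ∀ (n k : ℕ) (r : Fin n → Fin n → Prop),
      (core r (n - k)).card ≤ 2 ^ (7 * (n - k)) → Checks n k r chk (Q r)) :
    (directedDual Q).IsFPT :=
  isFPT_of_term (directedDual Q) DInst.n DInst.k (fun x => x.G.Adj) (fun _ => rfl)
    (fun _ => rfl) (.solve chk) hok
    fun x => holds_solve x.loopless (hQ _ x.loopless) chk (hchk _ _ _) _

theorem isFPT_UPP : UPP.IsFPT :=
  undirectedDual_isFPT _ _ Tm.ok_solve_path
    (fun _ hr => isPathKind_isPath hr) fun _ _ _ _ => checks_isPath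

theorem isFPT_UIPP : UIPP.IsFPT :=
  undirectedDual_isFPT _ _ Tm.ok_solve_induced
    (fun _ hr => isPathKind_isInducedPath hr) fun _ _ _ _ => checks_isInducedPath

theorem isFPT_USPP : USPP.IsFPT :=
  undirectedDual_isFPT _ _ Tm.ok_solve_shortest
    (fun _ hr => isPathKind_isShortestPath hr) fun _ _ _ h => checks_isShortestPath h

theorem isFPT_DIPP : DIPP.IsFPT :=
  directedDual_isFPT _ _ Tm.ok_solve_induced
    (fun _ hr => isPathKind_isInducedPath hr) fun _ _ _ _ => checks_isInducedPath

theorem isFPT_DSPP : DSPP.IsFPT :=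
  directedDual_isFPT _ _ Tm.ok_solve_shortest
    (fun _ hr => isPathKind_isShortestPath hr) fun _ _ _ h => checks_isShortestPath h

end Tractability

end PathPartition

theorem mainTheorem10 :
    PathPartition.UPP.IsFPT ∧ PathPartition.UIPP.IsFPT ∧ PathPartition.USPP.IsFPT ∧
      PathPartition.DIPP.IsFPT ∧ PathPartition.DSPP.IsFPT := by
  exact ⟨PathPartition.isFPT_UPP, PathPartition.isFPT_UIPP, PathPartition.isFPT_USPP,
    PathPartition.isFPT_DIPP, PathPartition.isFPT_DSPP⟩
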